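/- Let $$L(D_t,D_x)=D_t^m+\sum_{j=1}^m P_j(D_x)D_t^{m-j}+\sum_{l=0}^{m-1}\sum_{|\alpha|+r=l}c_{\alpha,r}D_x^\alpha D_t^r ,\qquad D=\tfrac1i\partial,$$ be a constant coefficient operator on $\mathbb R_t\times\mathbb R^n_x$, where $P_j$ is a homogeneous polynomial of degree $j$ and $c_{\alpha,r}\in\mathbb C$. Assume that $L$ is strictly hyperbolic, i.e. for every $\xi\neq0$ the principal symbol $\tau^m+\sum_{j}P_j(\xi)\tau^{m-j}$ has $m$ distinct real roots. Let $\tau_1(\xi),\dots,\tau_m(\xi)$ be the roots of the full symbol $L(\cdot,\xi)$, listed with multiplicity. For $0\le j\le m-1$ write $$E_j(t,\xi)=\sum_{k=1}^m e^{i\tau_k(\xi)t}A_j^k(t,\xi),$$ with $A_j^k(t,\xi)$ polynomial in $t$, for the solution of $L(D_t,\xi)E_j=0$, $D_t^lE_j(0,\xi)=\delta_{lj}$ $(0\le l\le m-1)$; thus the solution of $L(D_t,D_x)u=0$, $D_t^lu|_{t=0}=f_l$, is, up to the constant of Fourier inversion, $\sum_j\int e^{ix\cdot\xi}E_j(t,\xi)\widehat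 f_j(\xi)\,d\xi$, where $\widehat f(\xi)=\int e^{-ix\cdot\xi}f(x)\,dx$. Let $1\le L\le m$, let $\mathcal M\subset\mathbb R^n$ be bounded and put $\mathcal M^\delta=\{\xi:\operatorname{dist}(\xi,\mathcal M)<\delta\}$. Suppose that $\mathcal M$ has codimension $\ell$, meaning that $\ell$ is the largest $\nu\in\mathbb N$ such that $\operatorname{meas}(\mathcal M^\delta)\le C\delta^\nu$ for all small $\delta>0$. (The main case is that $\mathcal M$ is a $C^1$ set in which $\tau_1,\dots,\tau_L$ intersect; nothing of this is needed beyond what follows.) Let $\varepsilon>0$ be such that on $\mathcal M^\varepsilon$ none of $\tau_1,\dots,\tau_L$ coincides with any of $\tau_{L+1},\dots,\tau_m$, and the unordered $L$-tuple $\{\tau_1(\xi),\dots,\tau_L(\xi)\}$ depends continuously on $\xi$. Assume that for some $s>0$, $c_0>0$ $$c_0\operatorname{dist}(\xi,\mathcal M)^s\le\operatorname{Im}\tau_k(\xi),\qquad \xi\in\mathcal M^\varepsilon,\ k=1,\dots,L .$$ Let $\chi\in C_0^\infty(\mathcal M^\varepsilon)$ and $0\le j\le m-1$. Then for every $f\in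 C_0^\infty(\mathbb R^n)$ the integral $$v_f(t,x)=\int_{\mathcal M^\varepsilon}e^{ix\cdot\xi}\Big(\sum_{k=1}^L e^{i\tau_k(\xi)t}A_j^k(t,\xi)\Big)\chi(\xi)\widehat f(\xi)\,d\xi$$ converges absolutely and is a smooth function of $(t,x)$. Moreover, for all $r\in\mathbb N_0$, all multi-indices $\alpha$ and all $p,q$ with $1\le p\le2$, $\frac1p+\frac1q=1$, there is a constant $C$, independent of $t$ and $f$, such that for all $t\ge0$ and all $f\in C_0^\infty(\mathbb R^n)$ $$\big\|D_t^rD_x^\alpha v_f(t,\cdot)\big\|_{L^q(\mathbb R^n)}\le C\langle t\rangle^{-\frac{\ell}{s}\left(\frac1p-\frac1q\right)+L-1}\|f\|_{L^p(\mathbb R^n)},\qquad \langle t\rangle=(1+t^2)^{1/2}.$$ -/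

import Mathlib

open scoped ENNReal ContDiff

noncomputable section

namespace HypDecay

/-- Frequency / physical space `ℝⁿ` with its Euclidean structure. -/
abbrev E (n : ℕ) : Type := EuclideanSpace ℝ (Fin n)

/-- The monomial `ξ^α = ξ₁^{α₁} ⋯ ξₙ^{αₙ}` (as a complex number). -/
def monom {n : ℕ} (α : Fin n → ℕ) (ξ : E n) : ℂ := ∏ i, ((ξ i : ℝ) : ℂ) ^ α i

/-- The coefficients of a constant coefficient operator of order `m` in `D_t`, monic in `D_t`:
`D_t^m + ∑_{j=1}^m P_j(D_x) D_t^{m-j} + ∑_{l=0}^{m-1} ∑_{|α|+r=l} c_{α,r} D_x^α D_t^r`,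
with `P_j` a homogeneous polynomial of degree `j` and `c_{α,r} ∈ ℂ`.
Only `P j` with `1 ≤ j ≤ m` and `c α r` with `|α| + r < m` matter. -/
structure ConstCoeffOp (n m : ℕ) where
  P : ℕ → MvPolynomial (Fin n) ℂ
  P_homogeneous : ∀ j ∈ Finset.Icc 1 m, (P j).IsHomogeneous j
  c : (Fin n → ℕ) → ℕ → ℂ

/-- The principal symbol `L_m(τ,ξ) = τ^m + ∑_{j=1}^m P_j(ξ) τ^{m-j}`, as a polynomial in `τ`. -/
def ConstCoeffOp.principalSymbol {n m : ℕ} (O : ConstCoeffOp n m) (ξ : E n) : Polynomial ℂ :=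
  Polynomial.X ^ m + ∑ j ∈ Finset.Icc 1 m,
    Polynomial.C (MvPolynomial.eval (fun i => ((ξ i : ℝ) : ℂ)) (O.P j)) * Polynomial.X ^ (m - j)

/-- The full symbol `L(τ,ξ) = L_m(τ,ξ) + ∑_{l=0}^{m-1} ∑_{|α|+r=l} c_{α,r} ξ^α τ^r`,
as a polynomial in `τ`. -/
def ConstCoeffOp.symbol {n m : ℕ} (O : ConstCoeffOp n m) (ξ : E n) : Polynomial ℂ :=
  O.principalSymbol ξ + ∑ l ∈ Finset.range m, ∑ r ∈ Finset.range (l + 1),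
    ∑ α ∈ Finset.piAntidiag (Finset.univ : Finset (Fin n)) (l - r),
      Polynomial.C (O.c α r * monom α ξ) * Polynomial.X ^ r

/-- Strict hyperbolicity: for `ξ ≠ 0` the principal symbol has `m` pairwise distinct real roots.
(At `ξ = 0` the principal symbol is `τ^m`, whose roots are real.) -/
def ConstCoeffOp.StrictlyHyperbolic {n m : ℕ} (O : ConstCoeffOp n m) : Prop :=
  ∀ ξ : E n, ξ ≠ 0 → ∃ φ : Fin m → ℝ, Function.Injective φ ∧
    O.principalSymbol ξ = ∏ k, (Polynomial.X - Polynomial.C ((φ k : ℝ) : ℂ))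

/-- `τ₁(ξ), …, τ_m(ξ)` are the characteristic roots: the roots of `L(·,ξ)`, listed with
multiplicity. -/
def ConstCoeffOp.IsCharRoots {n m : ℕ} (O : ConstCoeffOp n m) (τ : Fin m → E n → ℂ) : Prop :=
  ∀ ξ : E n, O.symbol ξ = ∏ k, (Polynomial.X - Polynomial.C (τ k ξ))

/-- `D_t^r g (t)`, where `D_t = (1/i) ∂_t`. -/
def Dt (r : ℕ) (g : ℝ → ℂ) (t : ℝ) : ℂ := (1 / Complex.I) ^ r * iteratedDeriv r g t

/-- `D_{x_i} g = (1/i) ∂_{x_i} g`. -/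
def Dx1 {n : ℕ} (i : Fin n) (g : E n → ℂ) : E n → ℂ :=
  fun x => (1 / Complex.I) * fderiv ℝ g x (EuclideanSpace.single i (1 : ℝ))

/-- `D_x^α g = D_{x_1}^{α₁} ⋯ D_{x_n}^{αₙ} g`. -/
def Dx {n : ℕ} (α : Fin n → ℕ) (g : E n → ℂ) : E n → ℂ :=
  (List.finRange n).foldr (fun i h => (Dx1 i)^[α i] h) g

/-- The ordinary differential expression `L(D_t, ξ) v (t)` obtained from the operator by a partial
Fourier transform in `x`. -/
def ConstCoeffOp.odeOp {n m : ℕ} (O : ConstCoeffOp n m) (ξ : E n) (v : ℝ → ℂ) (t : ℝ) : ℂ :=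
  (O.symbol ξ).sum fun r a => a * Dt r v t

/-- Partial sum `∑_{k ∈ S} e^{i τ_k(ξ) t} A_j^k(t,ξ)`; here `A j k ξ` is the polynomial
`t ↦ A_j^k(t,ξ)`. -/
def partialPropagator {n m : ℕ} (τ : Fin m → E n → ℂ)
    (A : Fin m → Fin m → E n → Polynomial ℂ) (S : Finset (Fin m)) (j : Fin m)
    (t : ℝ) (ξ : E n) : ℂ :=
  ∑ k ∈ S, Complex.exp (Complex.I * τ k ξ * t) * (A j k ξ).eval (t : ℂ)

/-- `A_j^k(t,ξ)`, polynomials in `t`, are the amplitudes in the representation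
`u(t,x) = ∑_j ∫ e^{ix·ξ} (∑_{k=1}^m e^{iτ_k(ξ)t} A_j^k(t,ξ)) f̂_j(ξ) dξ`
of the solution of the Cauchy problem `L(D_t,D_x)u = 0`, `D_t^l u(0,·) = f_l`
(up to the constant of Fourier inversion): for every `j` and `ξ`, the function
`E_j(t,ξ) = ∑_{k=1}^m e^{iτ_k(ξ)t} A_j^k(t,ξ)` solves `L(D_t,ξ) E_j = 0` for `t ≥ 0` with
`D_t^l E_j(0,ξ) = δ_{lj}`, `0 ≤ l ≤ m-1`. -/
def ConstCoeffOp.IsAmplitudes {n m : ℕ} (O : ConstCoeffOp n m) (τ : Fin m → E n → ℂ)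
    (A : Fin m → Fin m → E n → Polynomial ℂ) : Prop :=
  ∀ (j : Fin m) (ξ : E n),
    (∀ t : ℝ, 0 ≤ t →
      O.odeOp ξ (fun t' => partialPropagator τ A Finset.univ j t' ξ) t = 0) ∧
    ∀ l : Fin m,
      Dt l.val (fun t' => partialPropagator τ A Finset.univ j t' ξ) 0 = if l = j then 1 else 0

/-- `f̂(ξ) = ∫ e^{-ix·ξ} f(x) dx`. -/
def fhat {n : ℕ} (f : E n → ℂ) (ξ : E n) : ℂ :=
  ∫ x : E n, Complex.exp (-(Complex.I * ((inner ℝ x ξ : ℝ) : ℂ))) * f x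

/-- The indices `k = 1, …, L` (in zero-based numbering). -/
def firstRoots (m L : ℕ) : Finset (Fin m) := Finset.univ.filter fun k => k.val < L

/-- The integrand `e^{ix·ξ} (∑_{k=1}^L e^{iτ_k(ξ)t} A_j^k(t,ξ)) χ(ξ) f̂(ξ)`. -/
def groupIntegrand {n m : ℕ} (τ : Fin m → E n → ℂ) (A : Fin m → Fin m → E n → Polynomial ℂ)
    (L : ℕ) (χ : E n → ℂ) (j : Fin m) (f : E n → ℂ) (t : ℝ) (x ξ : E n) : ℂ :=
  Complex.exp (Complex.I * ((inner ℝ x ξ : ℝ) : ℂ)) *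
    partialPropagator τ A (firstRoots m L) j t ξ * χ ξ * fhat f ξ

/-- The part `∫_U e^{ix·ξ} (∑_{k=1}^L e^{iτ_k(ξ)t} A_j^k(t,ξ)) χ(ξ) f̂(ξ) dξ` of the solution. -/
def groupPart {n m : ℕ} (τ : Fin m → E n → ℂ) (A : Fin m → Fin m → E n → Polynomial ℂ)
    (L : ℕ) (U : Set (E n)) (χ : E n → ℂ) (j : Fin m) (f : E n → ℂ) (t : ℝ) (x : E n) : ℂ :=
  ∫ ξ in U, groupIntegrand τ A L χ j f t x ξ

/-- `codim M = ℓ`: `ℓ` is the largest `ν ∈ ℕ` such that `meas(M^δ) ≤ C δ^ν` for all sufficiently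
small `δ > 0`, where `M^δ = {ξ : dist(ξ, M) < δ}`. -/
def HasCodim {n : ℕ} (M : Set (E n)) (l : ℕ) : Prop :=
  IsGreatest {ν : ℕ | ∃ C δ₀ : ℝ, 0 < δ₀ ∧ ∀ δ : ℝ, 0 < δ → δ < δ₀ →
    MeasureTheory.volume (Metric.thickening δ M) ≤ ENNReal.ofReal (C * δ ^ ν)} l

/-- `⟨t⟩ = (1 + t²)^{1/2}`. -/
def japanese (t : ℝ) : ℝ := Real.sqrt (1 + t ^ 2)

end HypDecay

end

/-! ### Plancherel and sup bounds for the unnormalized Fourier transform. -/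

noncomputable section
namespace HypDecay
open MeasureTheory FourierTransform SchwartzMap

/-! For fixed `t`, `D_t^r D_x^α v_f` is a Fourier multiplier applied to `f`, with symbol `b_t(ξ) =
ξ^α χ(ξ) D_t^r g(t,ξ)`, where `g = ∑_{k≤L} e^{iτ_k t} A_j^k`. Everything rests on the pointwise
bound `|b_t(ξ)| ≤ B ⟨t⟩^{L-1} exp(-c₀ dist(ξ,M)^s ⟨t⟩)`. Its supremum `X = B ⟨t⟩^{L-1}` controls L²
→ L² by Plancherel. Its integral controls L¹ → L^∞; since `{dist < δ}` has measure `O(δ^ℓ)`, slicing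
by the size of `⟨t⟩ dist^s` bounds it by `X` times a constant multiple of `⟨t⟩^{-ℓ/s}`.
Interpolating between the two with weight `θ = 1/p - 1/q` leaves `X` intact and raises the decay
factor to the power `θ`.

The pointwise bound cannot be read off termwise: the `A_j^k` are not unique where roots coincide and
may blow up nearby. Only the group sum `g` is well behaved. Write the symbol as `q₁ q₂`, with `q₁ =
∏_{k≤L} (X - τ_k)` and `q₂` the product over the other roots. Coprimality of `q₁` and `q₂` forces
`q₁(D_t) g = 0` (`aeval_prod_sum_polyExp`), and with `C` the companion operator of `q₁ q₂` the jet
of `g` is `(q₁+q₂)(C)⁻¹ q₂(C) exp(itC) e_j` (`jet_eq_of_add`). This contains only coefficients of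
`q₁` and `q₂`, which are continuous in `ξ`, so the jets at `t = 0` are bounded on the support of
`χ`. Integrating the first order factors of `q₁(D_t) g = 0` one at a time then gives `L - 1` powers
of `t` and the exponential rate `min Im τ_k`, with constants depending only on the initial jet and
the size of the roots (`norm_le_of_aeval_prod_eq_zero`). -/

theorem continuous_fourier_of_integrable {V : Type*} [NormedAddCommGroup V]
    [InnerProductSpace ℝ V] [FiniteDimensional ℝ V] [MeasurableSpace V] [BorelSpace V] {f : V → ℂ}
    (hf : Integrable f) : Continuous (𝓕 f) :=
  VectorFourier.fourierIntegral_continuous Real.continuous_fourierChar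
    (by exact continuous_inner) hf

/-- The two transforms have the same integrals against test functions: the L² one by its
compatibility with tempered distributions, the integral one because the Fourier kernel is symmetric.
This gives access to Plancherel. -/
theorem coeFn_fourier_toLp_ae_eq {V : Type*} [NormedAddCommGroup V] [InnerProductSpace ℝ V]
    [FiniteDimensional ℝ V] [MeasurableSpace V] [BorelSpace V] {f : V → ℂ}
    (hf : Integrable f) (hf2 : MemLp f 2) :
    (𝓕 (hf2.toLp f) : Lp ℂ 2 (volume : Measure V)) =ᵐ[volume] 𝓕 f := by
  have hcont := continuous_fourier_of_integrable hf
  refine ae_eq_of_integral_contDiff_smul_eq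
    ((Lp.memLp (𝓕 (hf2.toLp f))).locallyIntegrable (by norm_num)) hcont.locallyIntegrable ?_
  intro g hg hgc
  have hg' : ContDiff ℝ ∞ (fun x => (g x : ℂ)) := Complex.ofRealCLM.contDiff.comp hg
  have hgc' : HasCompactSupport (fun x => (g x : ℂ)) :=
    hgc.comp_left (g := fun y : ℝ => (y : ℂ)) Complex.ofReal_zero
  have h1 := congrArg (fun T => T (hgc'.toSchwartzMap hg'))
    (Lp.fourier_toTemperedDistribution_eq (hf2.toLp f))
  simp only [TemperedDistribution.fourier_apply, Lp.toTemperedDistribution_apply] at h1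
  calc ∫ x, g x • (𝓕 (hf2.toLp f) : Lp ℂ 2 (volume : Measure V)) x
      = ∫ x, (𝓕 (hgc'.toSchwartzMap hg')) x • (hf2.toLp f) x := by
        rw [h1]; rfl
    _ = ∫ x, (𝓕 (hgc'.toSchwartzMap hg')) x • f x := by
        refine integral_congr_ae ?_
        filter_upwards [hf2.coeFn_toLp] with x hx
        rw [hx]
    _ = ∫ x, g x • 𝓕 f x := by
        have h2 := VectorFourier.integral_fourierIntegral_smul_eq_flip (μ := (volume : Measure V))
          (ν := (volume : Measure V)) (L := innerₗ V) (f := fun x => (g x : ℂ)) (g := f)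
          Real.continuous_fourierChar (by exact continuous_inner)
          ((hg'.continuous).integrable_of_hasCompactSupport hgc') hf
        rw [flip_innerₗ] at h2
        exact h2

theorem eLpNorm_fourier_eq {V : Type*} [NormedAddCommGroup V] [InnerProductSpace ℝ V]
    [FiniteDimensional ℝ V] [MeasurableSpace V] [BorelSpace V] {f : V → ℂ}
    (hf : Integrable f) (hf2 : MemLp f 2) :
    eLpNorm (𝓕 f) 2 volume = eLpNorm f 2 volume := by
  rw [← eLpNorm_congr_ae (coeFn_fourier_toLp_ae_eq hf hf2)]
  have h := Lp.norm_fourier_eq (hf2.toLp f)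
  rw [Lp.norm_def, Lp.norm_def, ENNReal.toReal_eq_toReal_iff' (Lp.eLpNorm_ne_top _)
    (Lp.eLpNorm_ne_top _)] at h
  rw [h, eLpNorm_congr_ae hf2.coeFn_toLp]

theorem fhat_eq_fourier {n : ℕ} (f : E n → ℂ) (ξ : E n) :
    fhat f ξ = 𝓕 f ((2 * Real.pi)⁻¹ • ξ) := by
  rw [Real.fourier_eq', fhat]
  congr 1
  ext x
  rw [real_inner_smul_right, smul_eq_mul]
  have : -2 * Real.pi * ((2 * Real.pi)⁻¹ * inner ℝ x ξ) = - inner ℝ x ξ := by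
    field_simp
  rw [this]
  push_cast
  ring_nf

theorem continuous_fhat {n : ℕ} {f : E n → ℂ} (hf : Integrable f) : Continuous (fhat f) := by
  have : fhat f = fun ξ => 𝓕 f ((2 * Real.pi)⁻¹ • ξ) := funext (fhat_eq_fourier f)
  rw [this]
  exact (continuous_fourier_of_integrable hf).comp (by fun_prop)

theorem enorm_fhat_le {n : ℕ} (f : E n → ℂ) (ξ : E n) :
    ‖fhat f ξ‖ₑ ≤ eLpNorm f 1 volume := by
  rw [eLpNorm_one_eq_lintegral_enorm]
  refine (enorm_integral_le_lintegral_enorm _).trans (lintegral_mono fun x => ?_)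
  rw [enorm_mul]
  have : ‖Complex.exp (-(Complex.I * ((inner ℝ x ξ : ℝ) : ℂ)))‖ₑ = 1 := by
    rw [← ofReal_norm, Complex.norm_exp]; simp
  rw [this, one_mul]

theorem integrable_fhat_kernel {n : ℕ} {f : E n → ℂ} (hf : Integrable f) (ξ : E n) :
    Integrable (fun x => Complex.exp (-(Complex.I * ((inner ℝ x ξ : ℝ) : ℂ))) * f x) := by
  refine hf.bdd_mul (c := 1) (by fun_prop) (.of_forall fun x => ?_)
  rw [Complex.norm_exp]; simp

theorem fhat_add {n : ℕ} {f g : E n → ℂ} (hf : Integrable f) (hg : Integrable g) :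
    fhat (f + g) = fhat f + fhat g := by
  ext ξ
  simp only [fhat, Pi.add_apply, mul_add]
  exact integral_add (integrable_fhat_kernel hf ξ) (integrable_fhat_kernel hg ξ)

theorem exists_eLpNorm_fhat_le (n : ℕ) : ∃ c : ℝ, 0 < c ∧ ∀ f : E n → ℂ, Integrable f →
    MemLp f 2 → eLpNorm (fhat f) 2 volume ≤ ENNReal.ofReal c * eLpNorm f 2 volume := by
  -- Jacobian of the dilation by `(2π)⁻¹` relating `fhat` to the normalized transform; its square
  -- root is the Plancherel constant.
  set a : ℝ := |(((2 * Real.pi)⁻¹ : ℝ) ^ Module.finrank ℝ (E n))⁻¹| with ha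
  have hpi : (2 * Real.pi)⁻¹ ≠ 0 := by positivity
  have ha0 : 0 < a := abs_pos.mpr (inv_ne_zero (pow_ne_zero _ hpi))
  refine ⟨a ^ (1 / 2 : ℝ), by positivity, fun f hf hf2 => ?_⟩
  have : fhat f = (𝓕 f) ∘ fun ξ => (2 * Real.pi)⁻¹ • ξ := funext (fhat_eq_fourier f)
  rw [this, ← eLpNorm_map_measure
    (continuous_fourier_of_integrable hf).aestronglyMeasurable (by fun_prop),
    Measure.map_addHaar_smul volume hpi, eLpNorm_smul_measure_of_ne_top (by norm_num),
    eLpNorm_fourier_eq hf hf2, ← ha, smul_eq_mul]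
  gcongr
  rw [← ENNReal.ofReal_rpow_of_pos ha0]
  norm_num

end HypDecay
end

/-! ### Real interpolation on the line of dual exponents. -/

noncomputable section
namespace HypDecay
open MeasureTheory

theorem lintegral_Ioi_indicator_rpow {q Λ : ℝ} (hq : 2 < q) (hΛ : 0 < Λ) :
    ∫⁻ t in Set.Ioi (0 : ℝ), (Set.Iic Λ).indicator (fun t => ENNReal.ofReal (t ^ (q - 3))) t
      = ENNReal.ofReal (Λ ^ (q - 2) / (q - 2)) := by
  rw [lintegral_indicator measurableSet_Iic, Measure.restrict_restrict measurableSet_Iic,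
    Set.inter_comm, Set.Ioi_inter_Iic]
  have hint : IntervalIntegrable (fun t : ℝ => t ^ (q - 3)) volume 0 Λ :=
    intervalIntegral.intervalIntegrable_rpow' (by linarith)
  rw [← ofReal_integral_eq_lintegral_ofReal
    ((intervalIntegrable_iff_integrableOn_Ioc_of_le hΛ.le).mp hint)
    ((ae_restrict_iff' measurableSet_Ioc).mpr (.of_forall fun t ht => Real.rpow_nonneg ht.1.le _)),
    ← intervalIntegral.integral_of_le hΛ.le, integral_rpow (Or.inl (by linarith)),
    Real.zero_rpow (by linarith)]
  ring_nf

section Interpolation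

variable {X Y : Type*} [MeasurableSpace X] [MeasurableSpace Y] {μ : Measure X} {ν : Measure Y}
  {T : (X → ℂ) → Y → ℂ} {A B : ℝ}

/-- Marcinkiewicz splitting with a cut height adapted to `t`. Where `t|f|^{p-1} > 2AF` one has `|f|
≤ t|f|^p/(2AF)`, so that part has L¹ norm at most `t/(2A)` and its image never exceeds `t/2`. The
rest must account for the other `t/2`, and Chebyshev in L² produces the factor `4B²/t²`. -/
theorem measure_lt_norm_le_of_bounds
    (hadd : ∀ g h, Integrable g μ → Integrable h μ → T (g + h) = T g + T h)
    (hmeas : ∀ g, Integrable g μ → AEStronglyMeasurable (T g) ν)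
    (h1 : ∀ g, Integrable g μ → ∀ y, ‖T g y‖ₑ ≤ ENNReal.ofReal A * eLpNorm g 1 μ)
    (h2 : ∀ g, Integrable g μ → MemLp g 2 μ →
      eLpNorm (T g) 2 ν ≤ ENNReal.ofReal B * eLpNorm g 2 μ)
    (hA : 0 < A) {p F : ℝ} (hp : 1 < p) (hF : 0 < F) {f : X → ℂ}
    (hfm : Measurable f) (hf : Integrable f μ) (hf2 : MemLp f 2 μ)
    (hfp : ∫⁻ x, ENNReal.ofReal (‖f x‖ ^ p) ∂μ = ENNReal.ofReal F) {t : ℝ} (ht : 0 < t) :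
    ν {y | t < ‖T f y‖} ≤ ENNReal.ofReal (4 * B ^ 2 / t ^ 2) *
      ∫⁻ x, {x | t * ‖f x‖ ^ (p - 1) ≤ 2 * (A * F)}.indicator (fun x => ‖f x‖ₑ ^ 2) x ∂μ := by
  set s : Set X := {x | t * ‖f x‖ ^ (p - 1) ≤ 2 * (A * F)} with hs
  have hsm : MeasurableSet s := measurableSet_le (by fun_prop) (by fun_prop)
  have hsplit : f = s.indicator f + sᶜ.indicator f := (Set.indicator_self_add_compl s f).symm
  have hsi : Integrable (s.indicator f) μ := hf.indicator hsm
  have hci : Integrable (sᶜ.indicator f) μ := hf.indicator hsm.compl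
  have hs2 : MemLp (s.indicator f) 2 μ := hf2.indicator hsm
  have hTf : T f = T (s.indicator f) + T (sᶜ.indicator f) := by
    conv_lhs => rw [hsplit]
    exact hadd _ _ hsi hci
  have hbig : ∀ y, ‖T (sᶜ.indicator f) y‖ ≤ t / 2 := by
    intro y
    have hle : eLpNorm (sᶜ.indicator f) 1 μ ≤ ENNReal.ofReal (t / (2 * A)) := by
      rw [eLpNorm_one_eq_lintegral_enorm]
      calc ∫⁻ x, ‖sᶜ.indicator f x‖ₑ ∂μ
          ≤ ∫⁻ x, ENNReal.ofReal (t / (2 * (A * F))) * ENNReal.ofReal (‖f x‖ ^ p) ∂μ := by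
            refine lintegral_mono fun x => ?_
            by_cases hx : x ∈ s
            · simp [hx]
            · rw [Set.indicator_of_mem (by exact hx), ← ENNReal.ofReal_mul (by positivity),
                ← ofReal_norm]
              apply ENNReal.ofReal_le_ofReal
              have hx' : 2 * (A * F) < t * ‖f x‖ ^ (p - 1) := not_le.mp hx
              have h0 : 0 < ‖f x‖ := by
                by_contra h
                have h' : ‖f x‖ = 0 := le_antisymm (not_lt.mp h) (norm_nonneg _)
                rw [h', Real.zero_rpow (by linarith)] at hx'
                have : 0 < A * F := by positivity
                linarith
              have hpe : ‖f x‖ ^ p = ‖f x‖ ^ (p - 1) * ‖f x‖ := by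
                rw [← Real.rpow_add_one h0.ne']; ring_nf
              rw [hpe, div_mul_eq_mul_div, le_div_iff₀ (by positivity)]
              nlinarith
        _ = ENNReal.ofReal (t / (2 * (A * F))) * ENNReal.ofReal F := by
            rw [lintegral_const_mul' _ _ ENNReal.ofReal_ne_top, hfp]
        _ = ENNReal.ofReal (t / (2 * A)) := by
            rw [← ENNReal.ofReal_mul (by positivity)]
            congr 1
            field_simp
    have := (h1 _ hci y).trans (mul_le_mul_right hle _)
    rw [← ENNReal.ofReal_mul hA.le, ← ofReal_norm,
      ENNReal.ofReal_le_ofReal_iff (by positivity)] at this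
    calc _ ≤ _ := this
      _ = t / 2 := by field_simp
  have hsub : {y | t < ‖T f y‖} ⊆ {y | ENNReal.ofReal (t / 2) ≤ ‖T (s.indicator f) y‖ₑ} := by
    intro y hy
    simp only [Set.mem_ofPred_eq] at hy ⊢
    rw [← ofReal_norm]
    apply ENNReal.ofReal_le_ofReal
    rw [hTf] at hy
    have := norm_add_le (T (s.indicator f) y) (T (sᶜ.indicator f) y)
    have := hbig y
    simp only [Pi.add_apply] at hy
    linarith
  have hcheb := meas_ge_le_mul_pow_eLpNorm_enorm ν (p := 2) (by norm_num) (by norm_num)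
    (hmeas _ hsi) (ε := ENNReal.ofReal (t / 2)) (by simpa using ht) (by simp)
  refine (measure_mono hsub).trans (hcheb.trans ?_)
  have hsq : eLpNorm (s.indicator f) 2 μ ^ (2 : ℝ) = ∫⁻ x, s.indicator (fun x => ‖f x‖ₑ ^ 2) x ∂μ := by
    rw [eLpNorm_eq_lintegral_rpow_enorm_toReal (by norm_num) (by norm_num), ← ENNReal.rpow_mul]
    simp only [ENNReal.toReal_ofNat, one_div, isUnit_iff_ne_zero, ne_eq, OfNat.ofNat_ne_zero,
      not_false_eq_true, IsUnit.inv_mul_cancel, ENNReal.rpow_one]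
    refine lintegral_congr fun x => ?_
    by_cases hx : x ∈ s <;> simp [hx]
  calc _ ≤ (ENNReal.ofReal (t / 2))⁻¹ ^ (2 : ℝ) *
        (ENNReal.ofReal B * eLpNorm (s.indicator f) 2 μ) ^ (2 : ℝ) := by
        rw [ENNReal.toReal_ofNat]
        gcongr
        exact h2 _ hsi hs2
    _ ≤ _ := by
        rw [ENNReal.mul_rpow_of_nonneg _ _ (by norm_num), hsq, ← mul_assoc]
        gcongr
        rw [← ENNReal.ofReal_inv_of_pos (by positivity), ← ENNReal.mul_rpow_of_nonneg _ _ (by norm_num),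
          ← ENNReal.ofReal_mul (by positivity), ENNReal.rpow_ofNat]
        rcases le_total 0 B with hB | hB
        · rw [← ENNReal.ofReal_pow (by positivity)]
          apply ENNReal.ofReal_le_ofReal
          field_simp
          linarith
        · rw [ENNReal.ofReal_of_nonpos (mul_nonpos_of_nonneg_of_nonpos (by positivity) hB)]
          simp

/-- Real interpolation between `L¹ → L^∞` and `L² → L²` on the line of dual exponents. -/
theorem eLpNorm_le_of_one_top_of_two_two [SFinite μ]
    (hadd : ∀ g h, Integrable g μ → Integrable h μ → T (g + h) = T g + T h)
    (hmeas : ∀ g, Integrable g μ → AEStronglyMeasurable (T g) ν)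
    (h1 : ∀ g, Integrable g μ → ∀ y, ‖T g y‖ₑ ≤ ENNReal.ofReal A * eLpNorm g 1 μ)
    (h2 : ∀ g, Integrable g μ → MemLp g 2 μ →
      eLpNorm (T g) 2 ν ≤ ENNReal.ofReal B * eLpNorm g 2 μ)
    (hA : 0 < A) (hB : 0 < B) {p q : ℝ} (hpq : p.HolderConjugate q) (hp2 : p < 2) {f : X → ℂ}
    (hfm : Measurable f) (hf : Integrable f μ) (hf2 : MemLp f 2 μ)
    (hfLp : MemLp f (ENNReal.ofReal p) μ) :
    eLpNorm (T f) (ENNReal.ofReal q) ν ≤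
      ENNReal.ofReal ((4 * q * 2 ^ (q - 2) / (q - 2)) ^ (1 / q) * A ^ (p⁻¹ - q⁻¹) *
        B ^ (1 - (p⁻¹ - q⁻¹))) * eLpNorm f (ENNReal.ofReal p) μ := by
  have hp := hpq.lt
  have hq0 := hpq.symm.pos
  have hq : 2 < q := by
    have h := hpq.symm.inv_add_inv_eq_one
    have : (2 : ℝ)⁻¹ < p⁻¹ := inv_strictAnti₀ hpq.pos hp2
    have h3 : q⁻¹ < 2⁻¹ := by norm_num at *; linarith
    exact (inv_lt_inv₀ hq0 (by norm_num)).mp h3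
  have hp0' : ENNReal.ofReal p ≠ 0 := by simpa using hpq.pos
  have hp0 := hpq.pos
  have hq0' : ENNReal.ofReal q ≠ 0 := by simpa using hq0
  have hqp : (q - 1) * (p - 1) = 1 := by
    have := hpq.mul_eq_add
    linarith
  -- The splitting divides by `F = ∫|f|^p`, so `f = 0` a.e. is treated apart, through the L² bound.
  by_cases hzero : eLpNorm f (ENNReal.ofReal p) μ = 0
  · have hf0 : f =ᵐ[μ] 0 := (eLpNorm_eq_zero_iff hfLp.1 hp0').mp hzero
    have h : eLpNorm (T f) 2 ν = 0 := by
      have := h2 f hf hf2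
      rw [eLpNorm_congr_ae hf0, eLpNorm_zero, mul_zero] at this
      exact le_antisymm this (zero_le)
    rw [eLpNorm_eq_zero_iff (hmeas f hf) (by norm_num)] at h
    rw [eLpNorm_congr_ae h, eLpNorm_zero]
    exact zero_le
  set F : ℝ := (∫⁻ x, ENNReal.ofReal (‖f x‖ ^ p) ∂μ).toReal with hFdef
  have hnorm : eLpNorm f (ENNReal.ofReal p) μ
      = (∫⁻ x, ENNReal.ofReal (‖f x‖ ^ p) ∂μ) ^ (1 / p) := by
    rw [eLpNorm_eq_lintegral_rpow_enorm_toReal hp0' ENNReal.ofReal_ne_top,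
      ENNReal.toReal_ofReal hp0.le]
    congr 1
    refine lintegral_congr fun x => ?_
    rw [← ofReal_norm, ENNReal.ofReal_rpow_of_nonneg (norm_nonneg _) hp0.le]
  have hFtop : ∫⁻ x, ENNReal.ofReal (‖f x‖ ^ p) ∂μ ≠ ⊤ := by
    intro h
    rw [h, ENNReal.top_rpow_of_pos (by positivity)] at hnorm
    exact hfLp.2.ne hnorm
  have hF : 0 < F := by
    refine ENNReal.toReal_pos (fun h => hzero ?_) hFtop
    rw [hnorm, h, ENNReal.zero_rpow_of_pos (by positivity)]
  have hfp : ∫⁻ x, ENNReal.ofReal (‖f x‖ ^ p) ∂μ = ENNReal.ofReal F :=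
    (ENNReal.ofReal_toReal hFtop).symm
  -- Layer cake formula, then Fubini: the weight `t^{q-1}` against `t^{-2}` leaves `t^{q-3}`,
  -- integrable at `0` because `q > 2`.
  have hmain : ∫⁻ y, ENNReal.ofReal (‖T f y‖ ^ q) ∂ν ≤
      ENNReal.ofReal (4 * q * B ^ 2 * ((2 * (A * F)) ^ (q - 2) / (q - 2)) * F) := by
    rw [lintegral_rpow_eq_lintegral_meas_lt_mul ν (.of_forall fun y => norm_nonneg _)
      (hmeas f hf).norm.aemeasurable hq0]
    have hstep : ∀ t ∈ Set.Ioi (0 : ℝ),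
        ν {y | t < ‖T f y‖} * ENNReal.ofReal (t ^ (q - 1)) ≤
          ENNReal.ofReal (4 * B ^ 2) * ∫⁻ x, ‖f x‖ₑ ^ 2 *
            {z : ℝ × X | z.1 * ‖f z.2‖ ^ (p - 1) ≤ 2 * (A * F)}.indicator
              (fun z => ENNReal.ofReal (z.1 ^ (q - 3))) (t, x) ∂μ := by
      intro t ht
      have ht0 : 0 < t := ht
      refine (mul_le_mul_left (measure_lt_norm_le_of_bounds hadd hmeas h1 h2 hA hp hF hfm hf
        hf2 hfp ht0) _).trans ?_
      rw [mul_right_comm, ← ENNReal.ofReal_mul (by positivity)]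
      have : 4 * B ^ 2 / t ^ 2 * t ^ (q - 1) = 4 * B ^ 2 * t ^ (q - 3) := by
        rw [show q - 1 = (q - 3) + (2 : ℕ) by push_cast; ring, Real.rpow_add_natCast ht0.ne']
        field_simp
      rw [this, ENNReal.ofReal_mul (by positivity), mul_assoc,
        ← lintegral_const_mul' _ _ ENNReal.ofReal_ne_top]
      refine mul_le_mul_right (lintegral_mono fun x => ?_) _
      by_cases hx : t * ‖f x‖ ^ (p - 1) ≤ 2 * (A * F)
      · simp [Set.indicator, hx, mul_comm]
      · simp [Set.indicator, hx]
    have hms : MeasurableSet {z : ℝ × X | z.1 * ‖f z.2‖ ^ (p - 1) ≤ 2 * (A * F)} :=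
      measurableSet_le (by fun_prop) (by fun_prop)
    have hinner : ∀ x, ∫⁻ t in Set.Ioi (0 : ℝ), ‖f x‖ₑ ^ 2 *
          {z : ℝ × X | z.1 * ‖f z.2‖ ^ (p - 1) ≤ 2 * (A * F)}.indicator
              (fun z => ENNReal.ofReal (z.1 ^ (q - 3))) (t, x)
        ≤ ENNReal.ofReal ((2 * (A * F)) ^ (q - 2) / (q - 2)) * ENNReal.ofReal (‖f x‖ ^ p) := by
      intro x
      rw [lintegral_const_mul' _ _ (by simp)]
      rcases eq_or_ne (f x) 0 with h0 | h0
      · simp [h0]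
      have hu : 0 < ‖f x‖ := norm_pos_iff.mpr h0
      have hup : 0 < ‖f x‖ ^ (p - 1) := Real.rpow_pos_of_pos hu _
      have hcongr : ∀ t : ℝ, {z : ℝ × X | z.1 * ‖f z.2‖ ^ (p - 1) ≤ 2 * (A * F)}.indicator
          (fun z => ENNReal.ofReal (z.1 ^ (q - 3))) (t, x) =
          (Set.Iic (2 * (A * F) / ‖f x‖ ^ (p - 1))).indicator
            (fun t => ENNReal.ofReal (t ^ (q - 3))) t := by
        intro t
        simp [Set.indicator, le_div_iff₀ hup]
      simp_rw [hcongr]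
      rw [lintegral_Ioi_indicator_rpow hq (by positivity), ← ofReal_norm,
        ← ENNReal.ofReal_pow hu.le, ← ENNReal.ofReal_mul (by positivity),
        ← ENNReal.ofReal_mul (by have := sub_pos.mpr hq; positivity)]
      apply ENNReal.ofReal_le_ofReal
      rw [Real.div_rpow (by positivity) hup.le, ← Real.rpow_mul hu.le]
      -- Since `(p-1)(q-1) = 1`, the exponents satisfy `p + (p-1)(q-2) = 2`; so the `t`-integral
      -- turns `|f|²` into exactly `|f|^p`.
      have he : ‖f x‖ ^ 2 = ‖f x‖ ^ p * ‖f x‖ ^ ((p - 1) * (q - 2)) := by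
        rw [← Real.rpow_add hu, ← Real.rpow_natCast]
        congr 1
        push_cast
        linarith
      rw [he]
      have h4 : 0 < ‖f x‖ ^ ((p - 1) * (q - 2)) := Real.rpow_pos_of_pos hu _
      have h5 := sub_pos.mpr hq
      apply le_of_eq
      field_simp
    calc _ ≤ ENNReal.ofReal q * ∫⁻ t in Set.Ioi (0 : ℝ), ENNReal.ofReal (4 * B ^ 2) *
          ∫⁻ x, ‖f x‖ₑ ^ 2 * {z : ℝ × X | z.1 * ‖f z.2‖ ^ (p - 1) ≤ 2 * (A * F)}.indicator
              (fun z => ENNReal.ofReal (z.1 ^ (q - 3))) (t, x) ∂μ := by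
          gcongr 1
          exact setLIntegral_mono' measurableSet_Ioi hstep
      _ = ENNReal.ofReal (q * (4 * B ^ 2)) * ∫⁻ x, (∫⁻ t in Set.Ioi (0 : ℝ), ‖f x‖ₑ ^ 2 *
            {z : ℝ × X | z.1 * ‖f z.2‖ ^ (p - 1) ≤ 2 * (A * F)}.indicator
              (fun z => ENNReal.ofReal (z.1 ^ (q - 3))) (t, x)) ∂μ := by
          rw [lintegral_const_mul' _ _ ENNReal.ofReal_ne_top, ← mul_assoc,
            ← ENNReal.ofReal_mul hq0.le, lintegral_lintegral_swap]
          refine Measurable.aemeasurable ?_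
          refine Measurable.mul (by fun_prop) ?_
          exact (Measurable.indicator (by fun_prop) hms)
      _ ≤ ENNReal.ofReal (q * (4 * B ^ 2)) * ∫⁻ x,
            ENNReal.ofReal ((2 * (A * F)) ^ (q - 2) / (q - 2)) * ENNReal.ofReal (‖f x‖ ^ p) ∂μ := by
          gcongr with x
          exact hinner x
      _ = _ := by
          have h5 := sub_pos.mpr hq
          rw [lintegral_const_mul' _ _ ENNReal.ofReal_ne_top, hfp,
            ← ENNReal.ofReal_mul (by positivity), ← ENNReal.ofReal_mul (by positivity)]
          ring_nf
  have h5 := sub_pos.mpr hq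
  rw [hnorm, hfp, eLpNorm_eq_lintegral_rpow_enorm_toReal hq0' ENNReal.ofReal_ne_top,
      ENNReal.toReal_ofReal hq0.le, ENNReal.ofReal_rpow_of_pos hF,
      ← ENNReal.ofReal_mul (by positivity)]
  have heq : ∫⁻ y, ‖T f y‖ₑ ^ q ∂ν = ∫⁻ y, ENNReal.ofReal (‖T f y‖ ^ q) ∂ν :=
    lintegral_congr fun y => by
      rw [← ofReal_norm, ENNReal.ofReal_rpow_of_nonneg (norm_nonneg _) hq0.le]
  rw [heq]
  refine (ENNReal.rpow_le_rpow hmain (by positivity)).trans (le_of_eq ?_)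
  rw [ENNReal.ofReal_rpow_of_pos (by positivity)]
  congr 1
  have hpinv : p⁻¹ = 1 - q⁻¹ := by have := hpq.inv_add_inv_eq_one; linarith
  have hexp : 4 * q * B ^ 2 * ((2 * (A * F)) ^ (q - 2) / (q - 2)) * F =
      (4 * q * 2 ^ (q - 2) / (q - 2)) * A ^ (q - 2) * B ^ (2 : ℝ) * F ^ (q - 1) := by
    rw [Real.mul_rpow (by norm_num) (by positivity), Real.mul_rpow hA.le hF.le,
      show q - 1 = (q - 2) + 1 by ring, Real.rpow_add_one hF.ne', Real.rpow_ofNat]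
    ring
  rw [hexp, Real.mul_rpow (by positivity) (by positivity), Real.mul_rpow (by positivity)
    (by positivity), Real.mul_rpow (by positivity) (by positivity), ← Real.rpow_mul hA.le,
    ← Real.rpow_mul hB.le, ← Real.rpow_mul hF.le]
  have e1 : (q - 2) * (1 / q) = p⁻¹ - q⁻¹ := by rw [hpinv]; field_simp; ring
  have e2 : 2 * (1 / q) = 1 - (p⁻¹ - q⁻¹) := by rw [hpinv]; field_simp; ring
  have e3 : (q - 1) * (1 / q) = 1 / p := by rw [one_div p, hpinv]; field_simp
  rw [e1, e2, e3]

end Interpolation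
end HypDecay
end

/-! ### Codimension and integrals of exponentials of the distance. -/

noncomputable section
namespace HypDecay
open MeasureTheory

/-- The term `k = ⌊y⌋` alone dominates. Sublevel sets are used instead of shells because their
measure is what the codimension controls. -/
theorem ofReal_exp_neg_le_tsum {c y : ℝ} (hc : 0 < c) (hy : 0 ≤ y) :
    ENNReal.ofReal (Real.exp (-(c * y))) ≤
      ∑' k : ℕ, ENNReal.ofReal (Real.exp (-c) ^ k) * (Set.Iio ((k : ℝ) + 1)).indicator 1 y := by
  refine le_trans ?_ (ENNReal.le_tsum ⌊y⌋₊)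
  rw [Set.indicator_of_mem (show y ∈ Set.Iio _ from Nat.lt_floor_add_one y), Pi.one_apply, mul_one, ← Real.exp_nat_mul]
  apply ENNReal.ofReal_le_ofReal
  apply Real.exp_le_exp.mpr
  nlinarith [Nat.floor_le hy]

theorem summable_exp_pow_mul_rpow {c a : ℝ} (hc : 0 < c) :
    Summable fun k : ℕ => Real.exp (-c) ^ k * ((k : ℝ) + 1) ^ a := by
  obtain ⟨N, hN⟩ := exists_nat_ge a
  have h := summable_pow_mul_geometric_of_norm_lt_one (R := ℝ) N (r := Real.exp (-c))
    (by rw [Real.norm_eq_abs, abs_of_pos (Real.exp_pos _)]; simpa using hc)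
  have h1 := ((summable_nat_add_iff 1).mpr h).mul_left (Real.exp c)
  refine Summable.of_nonneg_of_le (fun k => by positivity) (fun k => ?_) h1
  have : ((k : ℝ) + 1) ^ a ≤ ((k : ℝ) + 1) ^ N := by
    rw [← Real.rpow_natCast]
    exact Real.rpow_le_rpow_of_exponent_le (by linarith [k.cast_nonneg (α := ℝ)]) hN
  calc Real.exp (-c) ^ k * ((k : ℝ) + 1) ^ a ≤ Real.exp (-c) ^ k * ((k : ℝ) + 1) ^ N := by gcongr
    _ = Real.exp c * Real.exp (-c) * (Real.exp (-c) ^ k * ((k : ℝ) + 1) ^ N) := by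
      rw [← Real.exp_add]; simp
    _ = _ := by rw [pow_succ]; push_cast; ring

/-- Exponential decay away from a set of codimension `l` gives polynomial decay of the integral. -/
theorem lintegral_exp_neg_infDist_le {X : Type*} [PseudoMetricSpace X] [MeasurableSpace X]
    [OpensMeasurableSpace X] (μ : Measure X) (M : Set X) (l : ℕ) {K c s : ℝ}
    (hc : 0 < c) (hs : 0 < s) (V : Set X)
    (hV : ∀ δ : ℝ, 0 < δ → μ (V ∩ {x | Metric.infDist x M < δ}) ≤ ENNReal.ofReal (K * δ ^ l)) :
    ∃ C : ℝ, 0 < C ∧ ∀ t : ℝ, 0 < t →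
      ∫⁻ x in V, ENNReal.ofReal (Real.exp (-(c * (t * Metric.infDist x M ^ s)))) ∂μ
        ≤ ENNReal.ofReal (C * t ^ (-((l : ℝ) / s))) := by
  set S : ℝ := ∑' k : ℕ, Real.exp (-c) ^ k * ((k : ℝ) + 1) ^ ((l : ℝ) / s) with hS
  have hsum := summable_exp_pow_mul_rpow (a := (l : ℝ) / s) hc
  have hS0 : 0 ≤ S := tsum_nonneg fun k => by positivity
  -- The `+ 1` only makes the constant positive.
  refine ⟨|K| * S + 1, by positivity, fun t ht => ?_⟩
  have hmeas : ∀ k : ℕ, MeasurableSet {x : X | t * Metric.infDist x M ^ s < (k : ℝ) + 1} := fun k =>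
    measurableSet_lt (((Metric.continuous_infDist_pt M).measurable.pow_const s).const_mul t)
      measurable_const
  have hset : ∀ k : ℕ, μ (V ∩ {x | t * Metric.infDist x M ^ s < (k : ℝ) + 1}) ≤
      ENNReal.ofReal (|K| * (((k : ℝ) + 1) ^ ((l : ℝ) / s) * t ^ (-((l : ℝ) / s)))) := by
    intro k
    have hk : (0 : ℝ) < (k : ℝ) + 1 := by positivity
    -- Solves `t δ^s = k + 1`, so the `k`-th sublevel set is the `δ`-neighbourhood; the factor
    -- `(k+1)^{l/s}` in `δ^l` is absorbed by `e^{-ck}`.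
    set δ : ℝ := (((k : ℝ) + 1) / t) ^ (s⁻¹) with hδ
    have hδ0 : 0 < δ := by positivity
    have hδl : δ ^ l = ((k : ℝ) + 1) ^ ((l : ℝ) / s) * t ^ (-((l : ℝ) / s)) := by
      rw [hδ, ← Real.rpow_natCast, ← Real.rpow_mul (by positivity), Real.div_rpow hk.le ht.le,
        Real.rpow_neg ht.le, inv_mul_eq_div, div_eq_mul_inv]
    have hsub : V ∩ {x | t * Metric.infDist x M ^ s < (k : ℝ) + 1} ⊆
        V ∩ {x | Metric.infDist x M < δ} := by
      refine fun x hx => ⟨hx.1, ?_⟩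
      have hx2 : t * Metric.infDist x M ^ s < (k : ℝ) + 1 := hx.2
      show Metric.infDist x M < δ
      rw [hδ, Real.lt_rpow_inv_iff_of_pos Metric.infDist_nonneg (by positivity) hs,
        lt_div_iff₀ ht]
      linarith
    refine (measure_mono hsub).trans ((hV δ hδ0).trans ?_)
    rw [hδl]
    apply ENNReal.ofReal_le_ofReal
    gcongr
    exact le_abs_self K
  calc ∫⁻ x in V, ENNReal.ofReal (Real.exp (-(c * (t * Metric.infDist x M ^ s)))) ∂μ
      ≤ ∫⁻ x in V, ∑' k : ℕ, ENNReal.ofReal (Real.exp (-c) ^ k) *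
          {x | t * Metric.infDist x M ^ s < (k : ℝ) + 1}.indicator 1 x ∂μ := by
        refine lintegral_mono fun x => (ofReal_exp_neg_le_tsum hc
          (mul_nonneg ht.le (Real.rpow_nonneg Metric.infDist_nonneg _))).trans (le_of_eq ?_)
        rfl
    _ = ∑' k : ℕ, ENNReal.ofReal (Real.exp (-c) ^ k) *
          μ (V ∩ {x | t * Metric.infDist x M ^ s < (k : ℝ) + 1}) := by
        rw [lintegral_tsum fun k => ((measurable_one.indicator (hmeas k)).const_mul _).aemeasurable]
        refine tsum_congr fun k => ?_
        rw [lintegral_const_mul' _ _ ENNReal.ofReal_ne_top, lintegral_indicator_one (hmeas k),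
          Measure.restrict_apply (hmeas k), Set.inter_comm]
    _ ≤ ∑' k : ℕ, ENNReal.ofReal ((|K| * t ^ (-((l : ℝ) / s))) *
          (Real.exp (-c) ^ k * ((k : ℝ) + 1) ^ ((l : ℝ) / s))) := by
        refine ENNReal.tsum_le_tsum fun k => (mul_le_mul_right (hset k) _).trans (le_of_eq ?_)
        rw [← ENNReal.ofReal_mul (by positivity)]
        congr 1
        ring
    _ = ENNReal.ofReal (|K| * t ^ (-((l : ℝ) / s)) * S) := by
        rw [← ENNReal.ofReal_tsum_of_nonneg (fun k => by positivity) (hsum.mul_left _),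
          tsum_mul_left]
    _ ≤ _ := by
        apply ENNReal.ofReal_le_ofReal
        have : 0 < t ^ (-((l : ℝ) / s)) := by positivity
        nlinarith

/-- For the empty set every exponent is admissible and there is no largest. Nonemptiness matters
because `Metric.infDist` to the empty set is `0` by convention. -/
theorem HasCodim.nonempty {n : ℕ} {M : Set (E n)} {l : ℕ} (h : HasCodim M l) : M.Nonempty := by
  by_contra hM
  rw [Set.not_nonempty_iff_eq_empty] at hM
  have : l + 1 ≤ l := h.2 ⟨0, 1, one_pos, fun δ _ _ => by simp [hM]⟩
  omega

/-- Removes the smallness of `δ`: for `δ ≥ δ₀` the volume of the bounded set `M^ε` is a constant,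
hence at most a multiple of `δ^l`. -/
theorem HasCodim.exists_volume_le {n : ℕ} {M : Set (E n)} {l : ℕ} (h : HasCodim M l)
    (hMb : Bornology.IsBounded M) (ε : ℝ) :
    ∃ K : ℝ, ∀ δ : ℝ, 0 < δ → volume (Metric.thickening ε M ∩ {x | Metric.infDist x M < δ}) ≤
      ENNReal.ofReal (K * δ ^ l) := by
  obtain ⟨C, δ₀, hδ₀, hC⟩ := h.1
  have hfin : volume (Metric.thickening ε M) ≠ ⊤ := (hMb.thickening (δ := ε)).measure_lt_top.ne
  set v := (volume (Metric.thickening ε M)).toReal with hv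
  have hv0 : 0 ≤ v := ENNReal.toReal_nonneg
  refine ⟨max C (v / δ₀ ^ l), fun δ hδ => ?_⟩
  rcases lt_or_ge δ δ₀ with hlt | hge
  · refine (measure_mono fun x hx => ?_).trans ((hC δ hδ hlt).trans
      (ENNReal.ofReal_le_ofReal (by gcongr; exact le_max_left _ _)))
    obtain ⟨y, hy, hxy⟩ := (Metric.infDist_lt_iff h.nonempty).mp hx.2
    exact Metric.mem_thickening_iff.mpr ⟨y, hy, hxy⟩
  · refine (measure_mono Set.inter_subset_left).trans ?_
    rw [← ENNReal.ofReal_toReal hfin]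
    apply ENNReal.ofReal_le_ofReal
    calc v = v / δ₀ ^ l * δ₀ ^ l := by field_simp
      _ ≤ v / δ₀ ^ l * δ ^ l := by gcongr
      _ ≤ _ := by gcongr; exact le_max_right _ _

theorem japanese_pos (t : ℝ) : 0 < japanese t := Real.sqrt_pos.mpr (by positivity)

theorem one_le_japanese (t : ℝ) : 1 ≤ japanese t := by
  rw [japanese, Real.one_le_sqrt]; nlinarith [sq_nonneg t]

theorem le_japanese (t : ℝ) : t ≤ japanese t := Real.le_sqrt_of_sq_le (by linarith)

theorem japanese_le_one_add {t : ℝ} (ht : 0 ≤ t) : japanese t ≤ 1 + t :=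
  Real.sqrt_le_iff.mpr ⟨by linarith, by nlinarith⟩

end HypDecay
end

/-! ### Exponential polynomials as a module over polynomials in `D_t`. -/

noncomputable section
namespace HypDecay
open Polynomial

/-- Real-analytic functions `ℝ → ℂ`. -/
def analyticFun : Submodule ℂ (ℝ → ℂ) where
  carrier := {g | ContDiff ℝ ω g}
  add_mem' {f g} hf hg := by
    rw [Set.mem_ofPred_eq] at *
    exact hf.add hg
  zero_mem' := by
    rw [Set.mem_ofPred_eq]
    exact contDiff_const
  smul_mem' c f hf := by
    rw [Set.mem_ofPred_eq] at *
    exact contDiff_const.smul hf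

namespace analyticFun

theorem contDiff (g : analyticFun) : ContDiff ℝ ω g.1 := g.2

theorem differentiable (g : analyticFun) : Differentiable ℝ g.1 :=
  (contDiff g).differentiable (by simp)

theorem contDiff_deriv (g : analyticFun) : ContDiff ℝ ω (deriv g.1) :=
  ((contDiff_succ_iff_deriv (n := ω)).mp (contDiff g)).2.2

/-- The operator `D_t = (1/i) d/dt` on real-analytic functions. -/
def D : Module.End ℂ analyticFun where
  toFun g := ⟨fun t => (1 / Complex.I) * deriv g.1 t, contDiff_const.mul (contDiff_deriv g)⟩
  map_add' f g := by
    ext t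
    have : deriv (f.1 + g.1) t = deriv f.1 t + deriv g.1 t :=
      deriv_add (differentiable f t) (differentiable g t)
    simp [this, mul_add]
  map_smul' c f := by
    ext t
    have : deriv (c • f.1) t = c * deriv f.1 t := by
      rw [deriv_const_smul _ (differentiable f t), smul_eq_mul]
    simp [this]
    ring

theorem D_apply (g : analyticFun) (t : ℝ) :
    (D g).1 t = (1 / Complex.I) * deriv g.1 t := rfl

theorem hasDerivAt (g : analyticFun) (t : ℝ) :
    HasDerivAt g.1 (Complex.I * (D g).1 t) t := by
  rw [D_apply, ← mul_assoc, mul_one_div_cancel Complex.I_ne_zero, one_mul]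
  exact (differentiable g t).hasDerivAt

theorem D_pow_apply (r : ℕ) (g : analyticFun) (t : ℝ) :
    ((D ^ r) g).1 t = Dt r g.1 t := by
  induction r generalizing t with
  | zero => simp [Dt]
  | succ r ih =>
    rw [pow_succ', Module.End.mul_apply, D_apply, funext ih]
    have h : deriv (Dt r g.1) t = (1 / Complex.I) ^ r * deriv (iteratedDeriv r g.1) t :=
      deriv_const_mul_field _
    rw [h, Dt, iteratedDeriv_succ]
    ring

theorem aeval_D_apply (p : ℂ[X]) (g : analyticFun) (t : ℝ) :
    (aeval D p g).1 t = p.sum fun r a => a * Dt r g.1 t := by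
  rw [aeval_def, eval₂_eq_sum, Polynomial.sum, Polynomial.sum, LinearMap.sum_apply,
    Submodule.coe_sum, Finset.sum_apply]
  refine Finset.sum_congr rfl fun r _ => ?_
  rw [← D_pow_apply]
  simp [Algebra.algebraMap_eq_smul_one]

/-- The amplitudes satisfy the differential equation only for `t ≥ 0`; analyticity extends it to the
whole line, where the algebra takes place. -/
theorem eq_zero_of_forall_nonneg {g : analyticFun} (h : ∀ t : ℝ, 0 ≤ t → g.1 t = 0) :
    g = 0 := by
  have hg : AnalyticOnNhd ℝ g.1 Set.univ := fun t _ => (contDiff g).contDiffAt.analyticAt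
  have h0 : AnalyticOnNhd ℝ (0 : ℝ → ℂ) Set.univ := analyticOnNhd_const
  have := hg.eqOn_of_preconnected_of_eventuallyEq h0 isPreconnected_univ (Set.mem_univ 1)
    (Filter.eventually_of_mem (Ioi_mem_nhds one_pos) fun t ht => h t (le_of_lt ht))
  ext t
  exact this (Set.mem_univ t)

end analyticFun

/-- The function `t ↦ e^{iτt} P(t)`. -/
def polyExp (τ : ℂ) (P : ℂ[X]) : analyticFun :=
  ⟨fun t => Complex.exp (Complex.I * τ * t) * P.eval (t : ℂ), by
    show ContDiff ℝ ω fun t : ℝ => Complex.exp (Complex.I * τ * t) * P.eval (t : ℂ)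
    refine ContDiff.mul ?_ ?_
    · exact Complex.contDiff_exp.comp (contDiff_const.mul Complex.ofRealCLM.contDiff)
    · have : ContDiff ℂ ω fun z : ℂ => P.eval z := by
        simp_rw [eval_eq_sum, Polynomial.sum]
        exact ContDiff.sum fun i _ => contDiff_const.mul (contDiff_id.pow i)
      exact (this.restrict_scalars ℝ).comp Complex.ofRealCLM.contDiff⟩

/-- Conjugation by `e^{iτt}` turns `D_t - τ` into `D_t`; hence `D_t - τ` is nilpotent on these
functions. -/
theorem D_sub_smul_polyExp (τ : ℂ) (P : ℂ[X]) :
    aeval analyticFun.D (X - C τ) (polyExp τ P) = (1 / Complex.I) • polyExp τ (derivative P) := by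
  ext t
  have h1 : HasDerivAt (fun t : ℝ => Complex.exp (Complex.I * τ * t))
      (Complex.exp (Complex.I * τ * t) * (Complex.I * τ * 1)) t :=
    ((Complex.ofRealCLM.hasDerivAt (x := t)).const_mul (Complex.I * τ)).cexp
  have h2 : HasDerivAt (fun t : ℝ => P.eval (t : ℂ)) ((derivative P).eval (t : ℂ)) t :=
    (P.hasDerivAt (t : ℂ)).comp_ofReal
  have h3 := (h1.mul h2).deriv
  have h4 : deriv (polyExp τ P).1 t = _ := h3
  simp only [map_sub, aeval_X, aeval_C, LinearMap.sub_apply, Module.algebraMap_end_apply,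
    Submodule.coe_sub, Submodule.coe_smul, Pi.sub_apply, Pi.smul_apply, smul_eq_mul,
    analyticFun.D_apply, h4]
  simp only [polyExp]
  field_simp
  ring

theorem polyExp_zero (τ : ℂ) : polyExp τ 0 = 0 := by
  ext t; simp [polyExp]

theorem aeval_X_sub_C_pow_polyExp (τ : ℂ) (N : ℕ) (P : ℂ[X]) (h : P.degree < N) :
    aeval analyticFun.D ((X - C τ) ^ N) (polyExp τ P) = 0 := by
  induction N generalizing P with
  | zero =>
    have : P = 0 := by simpa using h
    rw [this, polyExp_zero, map_zero]
  | succ N ih =>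
    rcases eq_or_ne P 0 with rfl | hP
    · rw [polyExp_zero, map_zero]
    · rw [pow_succ, map_mul, Module.End.mul_apply, D_sub_smul_polyExp, map_smul, ih, smul_zero]
      refine (degree_derivative_lt hP).trans_le ?_
      rw [degree_eq_natDegree hP] at h ⊢
      exact_mod_cast Nat.lt_succ_iff.mp (by exact_mod_cast h)

theorem eq_zero_of_isCoprime {R W : Type*} [CommRing R] [AddCommGroup W] [Module R W]
    {D : Module.End R W} {a b : R[X]} (hab : IsCoprime a b) {y : W} (ha : aeval D a y = 0)
    (hb : aeval D b y = 0) : y = 0 := by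
  obtain ⟨u, v, huv⟩ := hab
  have := congrArg (fun p => aeval D p y) huv
  simpa [ha, hb] using this.symm

theorem aeval_aeval_comm {R W : Type*} [CommRing R] [AddCommGroup W] [Module R W]
    {D : Module.End R W} {a : R[X]} (b : R[X]) {y : W} (h : aeval D a y = 0) :
    aeval D a (aeval D b y) = 0 := by
  rw [← Module.End.mul_apply, ← map_mul, mul_comm, map_mul, Module.End.mul_apply, h, map_zero]

/-- Here `q₁q₂(D) g` is killed by `a₁` and, being `-q₁q₂(D) h`, by `a₂`, so it vanishes. Then `q₁(D)
g` is killed by `q₂` and by `a₁`, so it vanishes too. The `aᵢ` may be crude annihilators of `g` and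
`h`; the conclusion is the sharp one. -/
theorem aeval_left_eq_zero_of_mul_add {R W : Type*} [CommRing R] [AddCommGroup W] [Module R W]
    {D : Module.End R W} {q₁ q₂ a₁ a₂ : R[X]} (h12 : IsCoprime a₁ a₂) (h1 : IsCoprime q₂ a₁)
    {g h : W} (hg : aeval D a₁ g = 0) (hh : aeval D a₂ h = 0)
    (hgh : aeval D (q₁ * q₂) (g + h) = 0) : aeval D q₁ g = 0 := by
  have hy : aeval D (q₁ * q₂) g = 0 := by
    refine eq_zero_of_isCoprime h12 (aeval_aeval_comm _ hg) ?_
    rw [map_add] at hgh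
    rw [eq_neg_of_add_eq_zero_left hgh, map_neg, aeval_aeval_comm _ hh, neg_zero]
  refine eq_zero_of_isCoprime h1 ?_ (aeval_aeval_comm _ hg)
  rw [← Module.End.mul_apply, ← map_mul, mul_comm, hy]

/-- When roots inside `S` coincide, the degrees of the `P k` are not bounded by multiplicities, and
single terms need not be killed by the product; only their sum is. -/
theorem aeval_prod_sum_polyExp {ι : Type*} [Fintype ι] (τ : ι → ℂ) (P : ι → ℂ[X]) (S S' : Finset ι)
    (hsep : ∀ k ∈ S, ∀ k' ∈ S', τ k ≠ τ k')
    (h : aeval analyticFun.D ((∏ k ∈ S, (X - C (τ k))) * ∏ k ∈ S', (X - C (τ k)))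
      ((∑ k ∈ S, polyExp (τ k) (P k)) + ∑ k ∈ S', polyExp (τ k) (P k)) = 0) :
    aeval analyticFun.D (∏ k ∈ S, (X - C (τ k))) (∑ k ∈ S, polyExp (τ k) (P k)) = 0 := by
  -- Larger than every degree, so the `N`-th power of each product kills its group term by term.
  set N : ℕ := (∑ k, (P k).natDegree) + 1 with hN
  have hdeg : ∀ k, (P k).degree < N := fun k => by
    refine (degree_le_natDegree).trans_lt ?_
    have := Finset.single_le_sum (f := fun k => (P k).natDegree) (fun _ _ => Nat.zero_le _)
      (Finset.mem_univ k)
    exact_mod_cast Nat.lt_succ_of_le this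
  have hkill : ∀ T : Finset ι, aeval analyticFun.D ((∏ k ∈ T, (X - C (τ k))) ^ N)
      (∑ k ∈ T, polyExp (τ k) (P k)) = 0 := by
    intro T
    rw [map_sum]
    refine Finset.sum_eq_zero fun k hk => ?_
    obtain ⟨w, hw⟩ := pow_dvd_pow_of_dvd (Finset.dvd_prod_of_mem (fun k => X - C (τ k)) hk) N
    rw [hw, mul_comm, map_mul, Module.End.mul_apply, aeval_X_sub_C_pow_polyExp _ _ _ (hdeg k),
      map_zero]
  have hcop : IsCoprime (∏ k ∈ S, (X - C (τ k))) (∏ k ∈ S', (X - C (τ k))) :=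
    IsCoprime.prod_left fun k hk => IsCoprime.prod_right fun k' hk' =>
      isCoprime_X_sub_C_of_isUnit_sub (sub_ne_zero.mpr (hsep k hk k' hk')).isUnit
  exact aeval_left_eq_zero_of_mul_add hcop.pow hcop.symm.pow_right (hkill S) (hkill S') h

end HypDecay
end

/-! ### Growth of solutions; jets and the companion operator. -/

noncomputable section
namespace HypDecay
open Polynomial

theorem norm_exp_neg_I_mul (τ : ℂ) (t : ℝ) :
    ‖Complex.exp (-(Complex.I * τ * t))‖ = Real.exp (τ.im * t) := by
  rw [Complex.norm_exp]
  simp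

open analyticFun in
/-- Solutions of `∏ (D_t - τ) g = 0` with `Im τ ≥ μ` grow at most like
`t ^ (degree - 1) * e ^ (-μ t)`. -/
theorem norm_le_of_aeval_prod_eq_zero {μ R : ℝ} (hR : 0 ≤ R) (τs : List ℂ)
    (hμ : ∀ τ ∈ τs, μ ≤ τ.im) (hτR : ∀ τ ∈ τs, ‖τ‖ ≤ R) {B : ℝ} (hB0 : 0 ≤ B) (g : analyticFun)
    (hg : aeval D (τs.map fun τ => X - C τ).prod g = 0)
    (hB : ∀ i < τs.length, ‖((D ^ i) g).1 0‖ ≤ B) {t : ℝ} (ht : 0 ≤ t) :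
    ‖g.1 t‖ ≤ B * (∑ i ∈ Finset.range τs.length, ((1 + R) * t) ^ i) * Real.exp (-(μ * t)) := by
  induction τs generalizing B g t with
  | nil =>
    have : g = 0 := by simpa using hg
    simp [this]
  | cons τ τs ih =>
    -- Peel off one factor: `g₁` solves the shorter equation, its initial jet is at most `(1+R)B`,
    -- and `g` is recovered by integrating `(e^{-iτt} g)' = i e^{-iτt} g₁`.
    set g₁ : analyticFun := D g - τ • g with hg₁
    have hg₁' : aeval D (X - C τ) g = g₁ := by
      simp [hg₁]
    have hτ : μ ≤ τ.im := hμ τ (by simp)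
    have hτR' : ‖τ‖ ≤ R := hτR τ (by simp)
    rw [List.map_cons, List.prod_cons, mul_comm, map_mul, Module.End.mul_apply, hg₁'] at hg
    have hD : ∀ i < τs.length, ‖((D ^ i) g₁).1 0‖ ≤ (1 + R) * B := by
      intro i hi
      have e : ((D ^ i) g₁).1 0 = ((D ^ (i + 1)) g).1 0 - τ * ((D ^ i) g).1 0 := by
        rw [hg₁, map_sub, map_smul, pow_succ, Module.End.mul_apply]
        rfl
      rw [e]
      have b1 := hB (i + 1) (by simpa using hi)
      have b2 := hB i (by simp; omega)
      calc _ ≤ ‖((D ^ (i + 1)) g).1 0‖ + ‖τ‖ * ‖((D ^ i) g).1 0‖ := by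
            rw [← norm_mul]; exact norm_sub_le _ _
        _ ≤ B + R * B := by gcongr
        _ = _ := by ring
    have hb : ∀ s : ℝ, 0 ≤ s → _ := fun s hs => ih (fun τ h => hμ τ (by simp [h]))
      (fun τ h => hτR τ (by simp [h])) (B := (1 + R) * B) (by positivity) g₁ hg hD (t := s) hs
    set S : ℝ := ∑ i ∈ Finset.range τs.length, ((1 + R) * t) ^ i with hS
    have hS0 : 0 ≤ S := Finset.sum_nonneg fun i _ => by positivity
    have hderiv : ∀ s : ℝ, HasDerivAt (fun s : ℝ => Complex.exp (-(Complex.I * τ * s)) * g.1 s)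
        (Complex.I * Complex.exp (-(Complex.I * τ * s)) * g₁.1 s) s := by
      intro s
      have h1 : HasDerivAt (fun s : ℝ => Complex.exp (-(Complex.I * τ * s)))
          (Complex.exp (-(Complex.I * τ * s)) * (-(Complex.I * τ * 1))) s :=
        ((Complex.ofRealCLM.hasDerivAt (x := s)).const_mul (Complex.I * τ)).neg.cexp
      convert! h1.mul (analyticFun.hasDerivAt g s) using 1
      have : g₁.1 s = (D g).1 s - τ * g.1 s := rfl
      rw [this]
      ring
    -- The inductive bound for `g₁` leaves `e^{(Im τ - μ)s}`, increasing in `s` because `μ ≤ Im τ`;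
    -- so its value at `t` bounds the derivative on `[0,t]`.
    have hmv := norm_image_sub_le_of_norm_deriv_le_segment' (a := 0) (b := t)
      (C := (1 + R) * B * S * Real.exp ((τ.im - μ) * t))
      (fun s _ => (hderiv s).hasDerivWithinAt) (by
        intro s hs
        rw [norm_mul, norm_mul, Complex.norm_I, one_mul, norm_exp_neg_I_mul]
        calc Real.exp (τ.im * s) * ‖g₁.1 s‖ ≤ Real.exp (τ.im * s) * ((1 + R) * B *
              (∑ i ∈ Finset.range τs.length, ((1 + R) * s) ^ i) * Real.exp (-(μ * s))) := by
              gcongr; exact hb s hs.1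
          _ = (1 + R) * B * (∑ i ∈ Finset.range τs.length, ((1 + R) * s) ^ i) *
              Real.exp ((τ.im - μ) * s) := by
              rw [sub_mul, sub_eq_add_neg, Real.exp_add]; ring
          _ ≤ _ := by
              have := hs.1
              have := hs.2.le
              rw [hS]
              gcongr) t ⟨ht, le_rfl⟩
    have hg0 : ‖g.1 0‖ ≤ B := by simpa using hB 0 (by simp)
    have hh : ‖Complex.exp (-(Complex.I * τ * t)) * g.1 t‖ ≤
        B + (1 + R) * B * S * Real.exp ((τ.im - μ) * t) * t := by
      have := norm_le_norm_add_norm_sub (Complex.exp (-(Complex.I * τ * (0 : ℝ))) * g.1 0)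
        (Complex.exp (-(Complex.I * τ * t)) * g.1 t)
      rw [norm_sub_rev] at hmv
      have h0 : ‖Complex.exp (-(Complex.I * τ * (0 : ℝ))) * g.1 0‖ ≤ B := by simpa using hg0
      rw [sub_zero] at hmv
      rw [norm_sub_rev] at hmv
      rw [norm_sub_rev] at this
      linarith
    rw [norm_mul, norm_exp_neg_I_mul] at hh
    -- The new bound `1 + (1+R) t S` is the geometric sum with one more term, which is why the sum
    -- has this shape.
    rw [List.length_cons, geom_sum_succ, ← hS]
    have hpos := Real.exp_pos (τ.im * t)
    have hle : Real.exp (-(τ.im * t)) ≤ Real.exp (-(μ * t)) := by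
      apply Real.exp_le_exp.mpr; nlinarith
    calc ‖g.1 t‖ = Real.exp (-(τ.im * t)) * (Real.exp (τ.im * t) * ‖g.1 t‖) := by
          rw [← mul_assoc, ← Real.exp_add]; simp
      _ ≤ Real.exp (-(τ.im * t)) * (B + (1 + R) * B * S * Real.exp ((τ.im - μ) * t) * t) := by
          gcongr
      _ = B * Real.exp (-(τ.im * t)) + B * ((1 + R) * t * S) * Real.exp (-(μ * t)) := by
          have : Real.exp (-(μ * t)) = Real.exp (-(τ.im * t)) * Real.exp ((τ.im - μ) * t) := by
            rw [← Real.exp_add]; ring_nf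
          rw [this]; ring
      _ ≤ B * Real.exp (-(μ * t)) + B * ((1 + R) * t * S) * Real.exp (-(μ * t)) := by gcongr
      _ = _ := by ring

/-- The companion operator of a monic polynomial of degree `m`, acting on jets
`(g, D g, …, D ^ (m - 1) g)`. -/
def companion (m : ℕ) (p : ℂ[X]) : (Fin m → ℂ) →L[ℂ] (Fin m → ℂ) :=
  LinearMap.toContinuousLinearMap
    { toFun v i := if h : i.val + 1 < m then v ⟨i.val + 1, h⟩ else -∑ k : Fin m, p.coeff k * v k
      map_add' v w := by
        ext i
        by_cases h : i.val + 1 < m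
        · simp [h]
        · simp [h, mul_add, Finset.sum_add_distrib, add_comm]
      map_smul' c v := by
        ext i
        by_cases h : i.val + 1 < m
        · simp [h]
        · simp [h, Finset.mul_sum, mul_left_comm] }

theorem companion_apply (m : ℕ) (p : ℂ[X]) (v : Fin m → ℂ) (i : Fin m) : companion m p v i =
    if h : i.val + 1 < m then v ⟨i.val + 1, h⟩ else -∑ k : Fin m, p.coeff k * v k := rfl

theorem companion_pow_apply_zero {m : ℕ} (hm : 0 < m) (p : ℂ[X]) (i : ℕ) (hi : i < m)
    (v : Fin m → ℂ) : (companion m p ^ i) v ⟨0, hm⟩ = v ⟨i, hi⟩ := by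
  induction i generalizing v with
  | zero => simp
  | succ i ih =>
    rw [pow_succ, mul_apply_eq_comp, ih (by omega), companion_apply, dif_pos hi]

theorem sum_coeff_mul_eq_of_monic {R : Type*} [Semiring R] {m : ℕ} {p : R[X]} (hp : p.Monic)
    (hpm : p.natDegree = m) (f : ℕ → R) :
    p.sum (fun i a => a * f i) = (∑ k : Fin m, p.coeff k * f k) + f m := by
  rw [sum_over_range _ (by simp), hpm, Finset.sum_range_succ, Finset.sum_range]
  have : p.coeff m = 1 := by rw [← hpm]; exact hp
  rw [this, one_mul]

/-- Cayley–Hamilton. The last row of `C` makes the zeroth component of `p(C)w` vanish for all `w`;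
the `i`-th component of `p(C)v` is the zeroth one of `C^i p(C) v = p(C) C^i v`. -/
theorem aeval_companion_self {m : ℕ} {p : ℂ[X]} (hp : p.Monic) (hpm : p.natDegree = m) :
    aeval (companion m p) p = 0 := by
  ext v i
  have hm : 0 < m := i.pos
  have key : ∀ w : Fin m → ℂ, aeval (companion m p) p w ⟨0, hm⟩ = 0 := by
    intro w
    have h1 : aeval (companion m p) p w ⟨0, hm⟩ =
        p.sum fun i a => a * (companion m p ^ i) w ⟨0, hm⟩ := by
      rw [aeval_def, eval₂_eq_sum, Polynomial.sum, Polynomial.sum, sum_apply,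
        Finset.sum_apply]
      refine Finset.sum_congr rfl fun r _ => ?_
      simp [Algebra.algebraMap_eq_smul_one]
    rw [h1, sum_coeff_mul_eq_of_monic hp hpm]
    obtain ⟨m, rfl⟩ := Nat.exists_eq_succ_of_ne_zero hm.ne'
    rw [pow_succ, mul_apply_eq_comp, companion_pow_apply_zero hm p m (by omega),
      companion_apply, dif_neg (by simp)]
    simp_rw [fun k : Fin (m + 1) => companion_pow_apply_zero hm p k.1 k.2 w]
    simp
  have hcomm : companion m p ^ i.val * aeval (companion m p) p =
      aeval (companion m p) p * companion m p ^ i.val := by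
    have : companion m p ^ i.val = aeval (companion m p) (X ^ i.val : ℂ[X]) := by simp
    rw [this, ← map_mul, ← map_mul, mul_comm]
  have h2 := companion_pow_apply_zero hm p i.val i.2 (aeval (companion m p) p v)
  rw [← mul_apply_eq_comp, hcomm, mul_apply_eq_comp, key] at h2
  rw [← h2]; rfl

open analyticFun

/-- The jet `(g, D g, …, D ^ (m - 1) g)` at `t`. -/
def jet (m : ℕ) (g : analyticFun) (t : ℝ) : Fin m → ℂ := fun i => ((D ^ i.val) g).1 t

theorem jet_D {m : ℕ} {p : ℂ[X]} (hp : p.Monic) (hpm : p.natDegree = m) {g : analyticFun}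
    (hg : aeval D p g = 0) (t : ℝ) : jet m (D g) t = companion m p (jet m g t) := by
  ext i
  have hi : jet m (D g) t i = ((D ^ (i.val + 1)) g).1 t := by
    rw [pow_succ, Module.End.mul_apply]; rfl
  rw [companion_apply, hi]
  split_ifs with h
  · rfl
  · have him : i.val + 1 = m := by omega
    have h0 : (aeval D p g).1 t = 0 := by rw [hg]; rfl
    rw [aeval_D_apply] at h0
    simp_rw [← D_pow_apply] at h0
    rw [sum_coeff_mul_eq_of_monic hp hpm] at h0
    rw [him, eq_neg_iff_add_eq_zero, add_comm]
    exact h0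

theorem jet_D_pow {m : ℕ} {p : ℂ[X]} (hp : p.Monic) (hpm : p.natDegree = m) {g : analyticFun}
    (hg : aeval D p g = 0) (t : ℝ) (N : ℕ) :
    jet m ((D ^ N) g) t = (companion m p ^ N) (jet m g t) := by
  induction N with
  | zero => rfl
  | succ N ih =>
    have : aeval D p ((D ^ N) g) = 0 := by
      simpa using aeval_aeval_comm (X ^ N) hg
    rw [pow_succ', Module.End.mul_apply, jet_D hp hpm this, ih, pow_succ',
      mul_apply_eq_comp]

theorem jet_add (m : ℕ) (g h : analyticFun) (t : ℝ) : jet m (g + h) t = jet m g t + jet m h t := by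
  ext i; simp [jet]

theorem jet_smul (m : ℕ) (c : ℂ) (g : analyticFun) (t : ℝ) : jet m (c • g) t = c • jet m g t := by
  ext i; simp [jet]

theorem jet_aeval {m : ℕ} {p : ℂ[X]} (hp : p.Monic) (hpm : p.natDegree = m) {g : analyticFun}
    (hg : aeval D p g = 0) (q : ℂ[X]) (t : ℝ) :
    jet m (aeval D q g) t = aeval (companion m p) q (jet m g t) := by
  induction q using Polynomial.induction_on' with
  | add a b ha hb => rw [map_add, LinearMap.add_apply, jet_add, ha, hb, map_add]; rfl
  | monomial N c =>
    rw [aeval_monomial, aeval_monomial, Module.End.mul_apply, Module.algebraMap_end_apply,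
      jet_smul, jet_D_pow hp hpm hg, Algebra.algebraMap_eq_smul_one]
    simp

/-- A Bézout identity `aq + bp = 1` evaluated at the companion operator, where `p` vanishes,
exhibits the inverse. -/
theorem isUnit_aeval_companion {m : ℕ} {p q : ℂ[X]} (hp : p.Monic) (hpm : p.natDegree = m)
    (hq : IsCoprime q p) : IsUnit (aeval (companion m p) q) := by
  obtain ⟨a, b, hab⟩ := hq
  have h := congrArg (aeval (companion m p)) hab
  rw [map_add, map_mul, map_mul, aeval_companion_self hp hpm, mul_zero, add_zero, map_one] at h
  exact ⟨⟨_, aeval (companion m p) a, by rw [← map_mul, mul_comm, map_mul, h], h⟩, rfl⟩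

/-- The jet solves `y' = iCy`, so `exp(-itC) y` is constant. -/
theorem jet_eq_exp {m : ℕ} {p : ℂ[X]} (hp : p.Monic) (hpm : p.natDegree = m) {g : analyticFun}
    (hg : aeval D p g = 0) (t : ℝ) :
    jet m g t = NormedSpace.exp ((t : ℂ) • (Complex.I • companion m p)) (jet m g 0) := by
  set A := Complex.I • companion m p with hA
  let _ : NormedAlgebra ℚ ((Fin m → ℂ) →L[ℂ] (Fin m → ℂ)) := NormedAlgebra.restrictScalars ℚ ℂ _
  have hjet : ∀ t, HasDerivAt (jet m g) (A (jet m g t)) t := by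
    intro t
    rw [hasDerivAt_pi]
    intro i
    have := analyticFun.hasDerivAt ((D ^ i.val) g) t
    convert! this using 1
    rw [hA, smul_apply, ← jet_D hp hpm hg, Pi.smul_apply, smul_eq_mul, jet,
      ← Module.End.mul_apply, ← Module.End.mul_apply, ← pow_succ, ← pow_succ']
  have hexp : ∀ t : ℝ, HasDerivAt (fun u : ℝ => NormedSpace.exp ((u : ℂ) • (-A)))
      (NormedSpace.exp ((t : ℂ) • (-A)) * (-A)) t := by
    intro t
    have h1 := hasDerivAt_exp_smul_const (-A) (t : ℂ)
    have h2 : HasDerivAt (fun u : ℝ => (u : ℂ)) 1 t := Complex.ofRealCLM.hasDerivAt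
    simpa [Function.comp_def] using HasDerivAt.scomp t h1 h2
  have hprod : ∀ t : ℝ,
      HasDerivAt (fun u : ℝ => NormedSpace.exp ((u : ℂ) • (-A)) (jet m g u)) 0 t := by
    intro t
    have h := (((ContinuousLinearMap.restrictScalarsL ℂ (Fin m → ℂ) (Fin m → ℂ) ℝ
      ℝ).hasFDerivAt).comp_hasDerivAt t (hexp t)).clm_apply (hjet t)
    convert! h using 1
    simp
  have hconst : NormedSpace.exp ((t : ℂ) • (-A)) (jet m g t) =
      NormedSpace.exp (((0 : ℝ) : ℂ) • (-A)) (jet m g 0) :=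
    is_const_of_deriv_eq_zero (fun t => (hprod t).differentiableAt)
      (fun t => (hprod t).deriv) t 0
  have h0 : ((0 : ℝ) : ℂ) • (-A) = 0 := by ext v i; simp
  rw [h0, NormedSpace.exp_zero, one_apply_eq_self] at hconst
  have h1 : (t : ℂ) • (-A) = -((t : ℂ) • A) := by ext v i; simp
  have h2 : NormedSpace.exp ((t : ℂ) • A) * NormedSpace.exp (-((t : ℂ) • A)) = 1 := by
    refine (NormedSpace.exp_add_of_commute (Commute.refl ((t : ℂ) • A)).neg_right).symm.trans ?_
    rw [add_neg_cancel, NormedSpace.exp_zero]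
  rw [← hconst, h1, ← mul_apply_eq_comp, h2, one_apply_eq_self]

/-- Because `q₁(D)g = 0` and `q₂(D)h = 0`, `q₂(D)(g+h) = q₂(D)g = (q₁+q₂)(D)g`, and `q₁+q₂` is
coprime to `q₁q₂`, hence invertible at `C`. The right side involves neither individual roots nor
amplitudes, only the two factors and the total initial data. -/
theorem jet_eq_of_add {m : ℕ} {q₁ q₂ : ℂ[X]} (hp : (q₁ * q₂).Monic)
    (hpm : (q₁ * q₂).natDegree = m) (hq : IsCoprime q₁ q₂) {g h : analyticFun}
    (hg : aeval D q₁ g = 0) (hh : aeval D q₂ h = 0) (t : ℝ) :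
    jet m g t = Ring.inverse (aeval (companion m (q₁ * q₂)) (q₁ + q₂))
      (aeval (companion m (q₁ * q₂)) q₂
        (NormedSpace.exp ((t : ℂ) • (Complex.I • companion m (q₁ * q₂))) (jet m (g + h) 0))) := by
  have hpg : aeval D (q₁ * q₂) g = 0 := by
    rw [mul_comm, map_mul, Module.End.mul_apply, hg, map_zero]
  have hph : aeval D (q₁ * q₂) h = 0 := by
    rw [map_mul, Module.End.mul_apply, hh, map_zero]
  have hpe : aeval D (q₁ * q₂) (g + h) = 0 := by rw [map_add, hpg, hph, add_zero]
  rw [← jet_eq_exp hp hpm hpe, ← jet_aeval hp hpm hpe, map_add (aeval D q₂), hh, add_zero]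
  have : aeval D q₂ g = aeval D (q₁ + q₂) g := by
    rw [map_add, LinearMap.add_apply, hg, zero_add]
  rw [this, jet_aeval hp hpm hpg, ← mul_apply_eq_comp, Ring.inverse_mul_cancel,
    one_apply_eq_self]
  refine isUnit_aeval_companion hp hpm (IsCoprime.mul_right ?_ ?_)
  · have := hq.symm.add_mul_left_left 1
    rwa [mul_one, add_comm] at this
  · have := hq.add_mul_left_left 1
    rwa [mul_one] at this

end HypDecay
end

/-! ### Continuity of the group contribution in the frequency. -/

noncomputable section
namespace HypDecay
open Polynomial analyticFun

section Continuity

variable {X : Type*} [TopologicalSpace X] {s : Set X} {x₀ : X}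

/-- With the nodes fixed, coefficients are fixed linear combinations of values, so continuity passes
from values to coefficients. -/
theorem coeff_eq_sum_eval_mul_basis {F : Type*} [Field F] [DecidableEq F] {P : F[X]} (T : Finset F)
    (hT : P.degree < T.card) (i : ℕ) :
    P.coeff i = ∑ z ∈ T, P.eval z * (Lagrange.basis T id z).coeff i := by
  conv_lhs => rw [Lagrange.eq_interpolate (s := T) (v := id) Function.injective_id.injOn hT]
  simp [Lagrange.interpolate_apply]

theorem continuousWithinAt_coeff_of_eval {P : X → ℂ[X]} (T : Finset ℂ)
    (hT : ∀ x, (P x).degree < T.card)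
    (h : ∀ z ∈ T, ContinuousWithinAt (fun x => (P x).eval z) s x₀) (i : ℕ) :
    ContinuousWithinAt (fun x => (P x).coeff i) s x₀ := by
  simp_rw [fun x => coeff_eq_sum_eval_mul_basis T (hT x) i]
  exact tendsto_finsetSum _ fun z hz => (h z hz).mul_const _

theorem exists_finset_card_eq_disjoint {F : Type*} [Infinite F] [DecidableEq F] (R : Finset F)
    (N : ℕ) : ∃ T : Finset F, T.card = N ∧ ∀ z ∈ T, z ∉ R := by
  have : Set.Infinite ((R : Set F)ᶜ) := R.finite_toSet.infinite_compl
  obtain ⟨T, hT, hc⟩ := this.exists_subset_card_eq N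
  exact ⟨T, hc, fun z hz hzR => hT hz hzR⟩

theorem continuousOn_coeff_of_eval {P : X → ℂ[X]} {N : ℕ} (hN : ∀ x, (P x).natDegree ≤ N)
    (h : ∀ z, ContinuousOn (fun x => (P x).eval z) s) (i : ℕ) :
    ContinuousOn (fun x => (P x).coeff i) s := by
  obtain ⟨T, hT, -⟩ := exists_finset_card_eq_disjoint (∅ : Finset ℂ) (N + 1)
  intro x hx
  refine continuousWithinAt_coeff_of_eval T (fun x => ?_) (fun z _ => h z x hx) i
  rw [hT]
  exact degree_le_natDegree.trans_lt (by exact_mod_cast Nat.lt_succ_of_le (hN x))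

/-- The cofactor of a continuous monic factor of a continuous polynomial is continuous. -/
theorem continuousOn_coeff_of_mul {P Q : X → ℂ[X]} {N : ℕ} (hN : ∀ x, (Q x).natDegree ≤ N)
    (hP0 : ∀ x, P x ≠ 0) (hP : ∀ z, ContinuousOn (fun x => (P x).eval z) s)
    (hPQ : ∀ z, ContinuousOn (fun x => (P x * Q x).eval z) s) (i : ℕ) :
    ContinuousOn (fun x => (Q x).coeff i) s := by
  intro x hx
  -- Nodes off the roots of `P x`, so that `Q = PQ / P` can be evaluated there at all points near
  -- `x`; the nodes depend on `x`.
  obtain ⟨T, hT, hTd⟩ := exists_finset_card_eq_disjoint (P x).roots.toFinset (N + 1)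
  refine continuousWithinAt_coeff_of_eval T (fun x => ?_) (fun z hz => ?_) i
  · rw [hT]
    exact degree_le_natDegree.trans_lt (by exact_mod_cast Nat.lt_succ_of_le (hN x))
  · have hz0 : (P x).eval z ≠ 0 := fun h =>
      hTd z hz (by rw [Multiset.mem_toFinset, mem_roots (hP0 x)]; exact h)
    have hdiv : ContinuousWithinAt (fun x => (P x * Q x).eval z / (P x).eval z) s x :=
      (hPQ z x hx).div (hP z x hx) hz0
    refine hdiv.congr_of_eventuallyEq ?_ ?_
    · filter_upwards [(hP z x hx).eventually_ne hz0] with y hy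
      rw [eval_mul, mul_div_cancel_left₀ _ hy]
    · rw [eval_mul, mul_div_cancel_left₀ _ hz0]

theorem continuousOn_companion {P : X → ℂ[X]} (hP : ∀ i, ContinuousOn (fun x => (P x).coeff i) s)
    (m : ℕ) : ContinuousOn (fun x => companion m (P x)) s := by
  rw [continuousOn_clm_apply]
  intro v
  rw [continuousOn_pi]
  intro i
  simp only [companion_apply]
  split_ifs with h
  · exact continuousOn_const
  · refine ContinuousOn.neg (f := fun y => ∑ k : Fin m, (P y).coeff k * v k) ?_
    exact continuousOn_finsetSum _ fun k _ => (hP k).mul continuousOn_const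

theorem continuousOn_aeval {A : Type*} [NormedRing A] [NormedAlgebra ℂ A] {Q : X → ℂ[X]} {N : ℕ}
    {c : X → A} (hN : ∀ x, (Q x).natDegree ≤ N)
    (hQ : ∀ i, ContinuousOn (fun x => (Q x).coeff i) s) (hc : ContinuousOn c s) :
    ContinuousOn (fun x => aeval (c x) (Q x)) s := by
  simp_rw [fun x => aeval_eq_sum_range' (Nat.lt_succ_of_le (hN x)) (c x)]
  exact continuousOn_finsetSum _ fun i _ => (hQ i).smul (hc.pow i)

end Continuity

theorem continuous_monom {n : ℕ} (α : Fin n → ℕ) : Continuous (monom α) := by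
  unfold monom
  fun_prop

theorem ConstCoeffOp.continuous_eval_symbol {n m : ℕ} (O : ConstCoeffOp n m) (z : ℂ) :
    Continuous fun ξ => (O.symbol ξ).eval z := by
  have h : ∀ j, Continuous fun ξ : E n => MvPolynomial.eval (fun i => ((ξ i : ℝ) : ℂ)) (O.P j) :=
    fun j => (MvPolynomial.continuous_eval (O.P j)).comp (by fun_prop)
  have h' := continuous_monom (n := n)
  simp only [ConstCoeffOp.symbol, ConstCoeffOp.principalSymbol, eval_add, eval_pow, eval_X,
    eval_finsetSum, eval_mul, eval_C]
  fun_prop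

theorem monic_prod_X_sub_C' {ι R : Type*} [CommRing R] (S : Finset ι) (τ : ι → R) :
    (∏ k ∈ S, (X - C (τ k))).Monic := monic_prod_of_monic _ _ fun k _ => monic_X_sub_C (τ k)

theorem natDegree_prod_X_sub_C {ι R : Type*} [CommRing R] [Nontrivial R] (S : Finset ι) (τ : ι → R) :
    (∏ k ∈ S, (X - C (τ k))).natDegree = S.card := by
  rw [natDegree_prod_of_monic _ _ fun k _ => monic_X_sub_C (τ k)]
  simp

/-- The function `t ↦ ∑_{k ∈ S} e^{i τ_k(ξ) t} A_j^k(t,ξ)`. -/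
def groupFun {n m : ℕ} (τ : Fin m → E n → ℂ) (A : Fin m → Fin m → E n → ℂ[X]) (S : Finset (Fin m))
    (j : Fin m) (ξ : E n) : analyticFun := ∑ k ∈ S, polyExp (τ k ξ) (A j k ξ)

theorem groupFun_coe {n m : ℕ} (τ : Fin m → E n → ℂ) (A : Fin m → Fin m → E n → ℂ[X])
    (S : Finset (Fin m)) (j : Fin m) (ξ : E n) :
    (groupFun τ A S j ξ).1 = fun t => partialPropagator τ A S j t ξ := by
  ext t
  rw [groupFun, Submodule.coe_sum, Finset.sum_apply]
  rfl

section Group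

variable {n m : ℕ} {O : ConstCoeffOp n m} {τ : Fin m → E n → ℂ} {A : Fin m → Fin m → E n → ℂ[X]}

theorem groupFun_add_compl (τ : Fin m → E n → ℂ) (A : Fin m → Fin m → E n → ℂ[X])
    (S : Finset (Fin m)) (j : Fin m) (ξ : E n) :
    groupFun τ A S j ξ + groupFun τ A Sᶜ j ξ = groupFun τ A Finset.univ j ξ :=
  Finset.sum_add_sum_compl S _

theorem aeval_symbol_groupFun_univ (hA : O.IsAmplitudes τ A) (j : Fin m) (ξ : E n) :
    aeval D (O.symbol ξ) (groupFun τ A Finset.univ j ξ) = 0 := by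
  refine eq_zero_of_forall_nonneg fun t ht => ?_
  rw [aeval_D_apply, groupFun_coe]
  exact (hA j ξ).1 t ht

theorem jet_groupFun_univ_zero (hA : O.IsAmplitudes τ A) (j : Fin m) (ξ : E n) :
    jet m (groupFun τ A Finset.univ j ξ) 0 = Pi.single j 1 := by
  ext i
  rw [jet, D_pow_apply, groupFun_coe, (hA j ξ).2 i, Pi.single_apply]

theorem aeval_prod_groupFun (hτ : O.IsCharRoots τ) (hA : O.IsAmplitudes τ A) (S : Finset (Fin m))
    (j : Fin m) (ξ : E n) (hsep : ∀ k ∈ S, ∀ k' ∈ Sᶜ, τ k ξ ≠ τ k' ξ) :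
    aeval D (∏ k ∈ S, (X - C (τ k ξ))) (groupFun τ A S j ξ) = 0 := by
  refine aeval_prod_sum_polyExp (fun k => τ k ξ) (fun k => A j k ξ) S Sᶜ hsep ?_
  rw [Finset.prod_mul_prod_compl, ← hτ ξ, Finset.sum_add_sum_compl]
  exact aeval_symbol_groupFun_univ hA j ξ

/-- All time derivatives of the contribution of a separated group of roots are jointly continuous
in time and frequency. -/
theorem continuousOn_D_pow_groupFun (hτ : O.IsCharRoots τ) (hA : O.IsAmplitudes τ A)
    (S : Finset (Fin m)) (j : Fin m) {V : Set (E n)}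
    (hcont : ∀ z : ℂ, ContinuousOn (fun ξ => ∏ k ∈ S, (z - τ k ξ)) V)
    (hsep : ∀ ξ ∈ V, ∀ k ∈ S, ∀ k' ∈ Sᶜ, τ k ξ ≠ τ k' ξ) (N : ℕ) :
    ContinuousOn (fun z : ℝ × E n => ((D ^ N) (groupFun τ A S j z.2)).1 z.1)
      (Set.univ ×ˢ V) := by
  let _ : NormedAlgebra ℚ ((Fin m → ℂ) →L[ℂ] (Fin m → ℂ)) := NormedAlgebra.restrictScalars ℚ ℂ _
  set q₁ : E n → ℂ[X] := fun ξ => ∏ k ∈ S, (X - C (τ k ξ)) with hq₁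
  set q₂ : E n → ℂ[X] := fun ξ => ∏ k ∈ Sᶜ, (X - C (τ k ξ)) with hq₂
  have hp : ∀ ξ, q₁ ξ * q₂ ξ = ∏ k, (X - C (τ k ξ)) := fun ξ => Finset.prod_mul_prod_compl _ _
  have hpm : ∀ ξ, (q₁ ξ * q₂ ξ).Monic := fun ξ => by rw [hp]; exact monic_prod_X_sub_C' _ _
  have hpd : ∀ ξ, (q₁ ξ * q₂ ξ).natDegree = m := fun ξ => by
    rw [hp, natDegree_prod_X_sub_C]; simp
  have hdeg : ∀ (T : Finset (Fin m)) ξ, (∏ k ∈ T, (X - C (τ k ξ))).natDegree ≤ m := fun T ξ => by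
    rw [natDegree_prod_X_sub_C]; simpa using T.card_le_univ
  have hcop : ∀ ξ ∈ V, IsCoprime (q₁ ξ) (q₂ ξ) := fun ξ hξ =>
    IsCoprime.prod_left fun k hk => IsCoprime.prod_right fun k' hk' =>
      isCoprime_X_sub_C_of_isUnit_sub (sub_ne_zero.mpr (hsep ξ hξ k hk k' hk')).isUnit
  have hev₁ : ∀ z, ContinuousOn (fun ξ => (q₁ ξ).eval z) V := fun z => by
    simpa [hq₁, eval_prod] using hcont z
  have hevp : ∀ z, ContinuousOn (fun ξ => (q₁ ξ * q₂ ξ).eval z) V := fun z => by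
    simp_rw [hp, ← hτ _]
    exact (O.continuous_eval_symbol z).continuousOn
  have hc₁ := continuousOn_coeff_of_eval (hdeg S) hev₁
  have hc₂ := continuousOn_coeff_of_mul (hdeg Sᶜ)
    (fun ξ => (monic_prod_X_sub_C' S fun k => τ k ξ).ne_zero) hev₁ hevp
  have hcp := continuousOn_coeff_of_eval (fun ξ => (hpd ξ).le) hevp
  have hC := continuousOn_companion hcp m
  have hQ : ContinuousOn (fun ξ => aeval (companion m (q₁ ξ * q₂ ξ)) (q₁ ξ + q₂ ξ)) V :=
    continuousOn_aeval (N := m) (fun ξ => (natDegree_add_le _ _).trans (max_le (hdeg S ξ) (hdeg _ ξ)))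
      (fun i => by simp_rw [coeff_add]; exact (hc₁ i).add (hc₂ i)) hC
  have hQ₂ := continuousOn_aeval (hdeg Sᶜ) hc₂ hC
  have hinv : ContinuousOn
      (fun ξ => Ring.inverse (aeval (companion m (q₁ ξ * q₂ ξ)) (q₁ ξ + q₂ ξ))) V := by
    intro ξ hξ
    obtain ⟨u, hu⟩ := isUnit_aeval_companion (hpm ξ) (hpd ξ) (q := q₁ ξ + q₂ ξ)
      (IsCoprime.mul_right (by simpa [add_comm] using (hcop ξ hξ).symm.add_mul_left_left 1)
        (by simpa using (hcop ξ hξ).add_mul_left_left 1))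
    have h := NormedRing.inverse_continuousAt u
    rw [hu] at h
    exact ContinuousAt.comp_continuousWithinAt (g := Ring.inverse) (x := ξ) h (hQ ξ hξ)
  have hsnd : Set.MapsTo Prod.snd ((Set.univ : Set ℝ) ×ˢ V) V := fun z hz => hz.2
  have hC2 : ContinuousOn (fun z : ℝ × E n => companion m (q₁ z.2 * q₂ z.2)) (Set.univ ×ˢ V) :=
    hC.comp continuousOn_snd hsnd
  have hexp : ContinuousOn (fun z : ℝ × E n => NormedSpace.exp
      ((z.1 : ℂ) • (Complex.I • companion m (q₁ z.2 * q₂ z.2)))) (Set.univ ×ˢ V) := by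
    refine NormedSpace.exp_continuous.comp_continuousOn ?_
    have h1 : ContinuousOn (fun z : ℝ × E n => (z.1 : ℂ)) (Set.univ ×ˢ V) := by fun_prop
    refine h1.smul ?_
    exact hC2.const_smul Complex.I
  have hjet : ContinuousOn (fun z : ℝ × E n => jet m ((D ^ N) (groupFun τ A S j z.2)) z.1)
      (Set.univ ×ˢ V) := by
    -- Since `D^N` acts on jets as `C^N`, the projected propagator formula covers all time
    -- derivatives at once.
    refine ContinuousOn.congr (f := fun z : ℝ × E n => (companion m (q₁ z.2 * q₂ z.2) ^ N)
      (Ring.inverse (aeval (companion m (q₁ z.2 * q₂ z.2)) (q₁ z.2 + q₂ z.2))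
      (aeval (companion m (q₁ z.2 * q₂ z.2)) (q₂ z.2) (NormedSpace.exp
        ((z.1 : ℂ) • (Complex.I • companion m (q₁ z.2 * q₂ z.2))) (Pi.single j 1))))) ?_ ?_
    · refine ContinuousOn.clm_apply ((hC.pow N).comp continuousOn_snd hsnd) ?_
      refine ContinuousOn.clm_apply (hinv.comp continuousOn_snd hsnd) ?_
      refine ContinuousOn.clm_apply (hQ₂.comp continuousOn_snd hsnd) ?_
      exact hexp.clm_apply continuousOn_const
    · rintro ⟨t, ξ⟩ ⟨-, hξ⟩
      have hg := aeval_prod_groupFun hτ hA S j ξ (hsep ξ hξ)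
      have hh := aeval_prod_groupFun hτ hA Sᶜ j ξ fun k hk k' hk' =>
        (hsep ξ hξ k' (by simpa using hk') k hk).symm
      have hpg : aeval D (q₁ ξ * q₂ ξ) (groupFun τ A S j ξ) = 0 := by
        rw [mul_comm, map_mul, Module.End.mul_apply]
        exact (congrArg _ hg).trans (map_zero _)
      have := jet_eq_of_add (hpm ξ) (hpd ξ) (hcop ξ hξ) hg hh t
      rw [groupFun_add_compl, jet_groupFun_univ_zero hA] at this
      simp only
      rw [jet_D_pow (hpm ξ) (hpd ξ) hpg, this]
  -- The zeroth jet component is the function itself; it exists because `j : Fin m` gives `0 < m`.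
  have h0 := (continuousOn_pi.mp hjet) ⟨0, j.pos⟩
  exact h0

end Group

end HypDecay
end

/-! ### Uniform time decay of the group contribution on compact sets. -/

noncomputable section
namespace HypDecay
open Polynomial analyticFun

theorem geom_sum_one_add_mul_le {R t : ℝ} (hR : 0 ≤ R) (ht : 0 ≤ t) (N : ℕ) :
    ∑ i ∈ Finset.range N, ((1 + R) * t) ^ i ≤ N * ((1 + R) * (1 + t)) ^ (N - 1) := by
  have h : ∀ i ∈ Finset.range N, ((1 + R) * t) ^ i ≤ ((1 + R) * (1 + t)) ^ (N - 1) := by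
    intro i hi
    have hi' := Finset.mem_range.mp hi
    calc ((1 + R) * t) ^ i ≤ ((1 + R) * (1 + t)) ^ i := by gcongr; linarith
      _ ≤ _ := pow_le_pow_right₀ (by nlinarith) (by omega)
  simpa using Finset.sum_le_sum h

section Group

variable {n m : ℕ} {O : ConstCoeffOp n m} {τ : Fin m → E n → ℂ} {A : Fin m → Fin m → E n → ℂ[X]}

/-- Single roots need not be continuous in `ξ`, but Cauchy's bound needs only the coefficients of
the symbol, which are. -/
theorem exists_norm_root_le (hτ : O.IsCharRoots τ) {K : Set (E n)} (hK : IsCompact K) :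
    ∃ R : ℝ, 0 ≤ R ∧ ∀ ξ ∈ K, ∀ k, ‖τ k ξ‖ ≤ R := by
  have hmon : ∀ ξ, (O.symbol ξ).Monic := fun ξ => by rw [hτ]; exact monic_prod_X_sub_C' _ _
  have hdeg : ∀ ξ, (O.symbol ξ).natDegree = m := fun ξ => by
    rw [hτ, natDegree_prod_X_sub_C]; simp
  have hc := continuousOn_coeff_of_eval (s := K) (fun ξ => (hdeg ξ).le)
    fun z => (O.continuous_eval_symbol z).continuousOn
  choose B hB using fun i => hK.exists_bound_of_continuousOn (hc i)
  have hB' : ∀ i, B i ≤ ∑ i ∈ Finset.range (m + 1), |B i| ∨ m < i := by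
    intro i
    by_cases hi : i < m + 1
    · exact Or.inl ((le_abs_self _).trans (Finset.single_le_sum (f := fun i => |B i|)
        (fun _ _ => abs_nonneg _) (Finset.mem_range.mpr hi)))
    · exact Or.inr (by omega)
  have hS : 0 ≤ ∑ i ∈ Finset.range (m + 1), |B i| := Finset.sum_nonneg fun _ _ => abs_nonneg _
  refine ⟨(∑ i ∈ Finset.range (m + 1), |B i|) + 1, by positivity, fun ξ hξ k => ?_⟩
  have hroot : (O.symbol ξ).IsRoot (τ k ξ) := by
    rw [hτ, IsRoot.def, eval_prod]
    exact Finset.prod_eq_zero (Finset.mem_univ k) (by simp)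
  have hlt : ‖τ k ξ‖ ≤ cauchyBound (O.symbol ξ) :=
    (hroot.norm_lt_cauchyBound (hmon ξ).ne_zero).le
  refine hlt.trans ?_
  rw [cauchyBound, (hmon ξ).leadingCoeff, nnnorm_one, div_one, NNReal.coe_add, NNReal.coe_one]
  gcongr
  rw [← Real.le_toNNReal_iff_coe_le hS]
  refine Finset.sup_le fun i hi => ?_
  rw [Real.le_toNNReal_iff_coe_le hS, coe_nnnorm]
  rw [hdeg, Finset.mem_range] at hi
  exact (hB i ξ hξ).trans ((hB' i).resolve_right (by omega))

/-- Uniform decay in time of the contribution of a separated group of roots. -/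
theorem exists_norm_D_pow_groupFun_le (hτ : O.IsCharRoots τ) (hA : O.IsAmplitudes τ A)
    (S : Finset (Fin m)) (j : Fin m) {V K : Set (E n)} (hK : IsCompact K) (hKV : K ⊆ V)
    (hcont : ∀ z : ℂ, ContinuousOn (fun ξ => ∏ k ∈ S, (z - τ k ξ)) V)
    (hsep : ∀ ξ ∈ V, ∀ k ∈ S, ∀ k' ∈ Sᶜ, τ k ξ ≠ τ k' ξ) {d : E n → ℝ}
    (him : ∀ ξ ∈ V, ∀ k ∈ S, d ξ ≤ (τ k ξ).im) (N : ℕ) :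
    ∃ B : ℝ, 0 ≤ B ∧ ∀ ξ ∈ K, ∀ t : ℝ, 0 ≤ t → ‖((D ^ N) (groupFun τ A S j ξ)).1 t‖ ≤
      B * (1 + t) ^ (S.card - 1) * Real.exp (-(d ξ * t)) := by
  obtain ⟨R, hR, hτR⟩ := exists_norm_root_le hτ hK
  have hc0 : ∀ i, ContinuousOn (fun ξ => ((D ^ (i + N)) (groupFun τ A S j ξ)).1 0) K := fun i =>
    ((continuousOn_D_pow_groupFun hτ hA S j hcont hsep (i + N)).comp
      (f := fun ξ => ((0 : ℝ), ξ)) (by fun_prop) fun ξ hξ => ⟨Set.mem_univ _, hKV hξ⟩)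
  choose B hB using fun i => hK.exists_bound_of_continuousOn (hc0 i)
  set b := ∑ i ∈ Finset.range S.card, |B i| with hb
  have hb0 : 0 ≤ b := Finset.sum_nonneg fun _ _ => abs_nonneg _
  refine ⟨b * (S.card * (1 + R) ^ (S.card - 1)), by positivity, fun ξ hξ t ht => ?_⟩
  have hprod : (((S.toList.map fun k => τ k ξ).map fun τ => X - C τ)).prod =
      ∏ k ∈ S, (X - C (τ k ξ)) := by
    rw [List.map_map, ← Finset.prod_map_toList]; rfl
  have hlen : (S.toList.map fun k => τ k ξ).length = S.card := by simp
  -- `D^N` commutes with `q₁(D)`, so `D^N g` solves the same equation and only its initial jet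
  -- changes.
  have key := norm_le_of_aeval_prod_eq_zero (μ := d ξ) hR (S.toList.map fun k => τ k ξ)
    (by
      intro z hz
      obtain ⟨k, hk, rfl⟩ := List.mem_map.mp hz
      exact him ξ (hKV hξ) k (Finset.mem_toList.mp hk))
    (by
      intro z hz
      obtain ⟨k, -, rfl⟩ := List.mem_map.mp hz
      exact hτR ξ hξ k) hb0 ((D ^ N) (groupFun τ A S j ξ))
    (by
      rw [hprod]
      have := aeval_aeval_comm (X ^ N) (aeval_prod_groupFun hτ hA S j ξ (hsep ξ (hKV hξ)))
      simpa using this)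
    (by
      intro i hi
      rw [hlen] at hi
      rw [← Module.End.mul_apply, ← pow_add]
      exact (hB i ξ hξ).trans ((le_abs_self _).trans (Finset.single_le_sum (f := fun i => |B i|)
        (fun _ _ => abs_nonneg _) (Finset.mem_range.mpr hi)))) ht
  rw [hlen] at key
  refine key.trans (mul_le_mul_of_nonneg_right ?_ (Real.exp_pos _).le)
  calc b * ∑ i ∈ Finset.range S.card, ((1 + R) * t) ^ i
      ≤ b * (S.card * ((1 + R) * (1 + t)) ^ (S.card - 1)) := by
        gcongr; exact geom_sum_one_add_mul_le hR ht _
    _ = _ := by rw [mul_pow]; ring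

end Group

end HypDecay
end

/-! ### Differentiating the oscillatory integral. -/

noncomputable section
namespace HypDecay
open MeasureTheory

section Oscillatory

variable {n : ℕ} {a : ℕ → ℝ → E n → ℂ}

/-- The integrand `e^{ix·ξ} a_N(t,ξ) g(ξ)`. -/
def oscIntegrand (a : ℕ → ℝ → E n → ℂ) (g : E n → ℂ) (N : ℕ) (z : ℝ × E n) (ξ : E n) : ℂ :=
  Complex.exp (Complex.I * ((inner ℝ z.2 ξ : ℝ) : ℂ)) * a N z.1 ξ * g ξ

/-- The integral `∫ e^{ix·ξ} a_N(t,ξ) g(ξ) dξ`. -/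
def oscIntegral (a : ℕ → ℝ → E n → ℂ) (g : E n → ℂ) (N : ℕ) (z : ℝ × E n) : ℂ :=
  ∫ ξ, oscIntegrand a g N z ξ

/-- The coordinate `(t, x) ↦ t` as a complex valued map. -/
def timeCLM (n : ℕ) : ℝ × E n →L[ℝ] ℂ := Complex.ofRealCLM.comp (ContinuousLinearMap.fst ℝ ℝ (E n))

/-- The coordinate `(t, x) ↦ x_i` as a complex valued map. -/
def coordCLM {n : ℕ} (i : Fin n) : ℝ × E n →L[ℝ] ℂ :=
  Complex.ofRealCLM.comp ((EuclideanSpace.proj i : E n →L[ℝ] ℝ).comp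
    (ContinuousLinearMap.snd ℝ ℝ (E n)))

/-- The derivative of `oscIntegrand` in `(t, x)`. -/
def oscIntegrandDeriv (a : ℕ → ℝ → E n → ℂ) (g : E n → ℂ) (N : ℕ) (z : ℝ × E n) (ξ : E n) :
    ℝ × E n →L[ℝ] ℂ :=
  (Complex.I * oscIntegrand a g (N + 1) z ξ) • timeCLM n +
    ∑ i, (Complex.I * oscIntegrand a (fun ξ => ((ξ i : ℝ) : ℂ) * g ξ) N z ξ) • coordCLM i

theorem continuous_oscIntegrand (hcont : ∀ N, Continuous fun z : ℝ × E n => a N z.1 z.2)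
    {g : E n → ℂ} (hg : Continuous g) (N : ℕ) :
    Continuous fun y : (ℝ × E n) × E n => oscIntegrand a g N y.1 y.2 := by
  have h : Continuous fun y : (ℝ × E n) × E n => a N y.1.1 y.2 :=
    (hcont N).comp (f := fun y : (ℝ × E n) × E n => (y.1.1, y.2)) (by fun_prop)
  unfold oscIntegrand
  fun_prop

theorem sum_smul_coordCLM_apply (ξ : E n) (z : ℝ × E n) :
    (∑ i, ((ξ i : ℝ) : ℂ) • coordCLM (n := n) i) z = ((inner ℝ z.2 ξ : ℝ) : ℂ) := by
  simp [coordCLM, PiLp.inner_apply]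

theorem hasFDerivAt_oscIntegrand
    (hderiv : ∀ N ξ t, HasDerivAt (fun t => a N t ξ) (Complex.I * a (N + 1) t ξ) t)
    (g : E n → ℂ) (N : ℕ) (ξ : E n) (z : ℝ × E n) :
    HasFDerivAt (fun z => oscIntegrand a g N z ξ) (oscIntegrandDeriv a g N z ξ) z := by
  have h1 : HasFDerivAt (fun z : ℝ × E n => ((inner ℝ z.2 ξ : ℝ) : ℂ))
      (∑ i, ((ξ i : ℝ) : ℂ) • coordCLM (n := n) i) z := by
    have := (∑ i, ((ξ i : ℝ) : ℂ) • coordCLM (n := n) i).hasFDerivAt (x := z)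
    refine this.congr_of_eventuallyEq (.of_forall fun z => ?_)
    exact (sum_smul_coordCLM_apply ξ z).symm
  have h2 := (h1.const_mul Complex.I).cexp
  have h3 : HasFDerivAt (fun z : ℝ × E n => a N z.1 ξ) _ z :=
    (hderiv N ξ z.1).hasFDerivAt.comp z (hasFDerivAt_fst (𝕜 := ℝ) (p := z))
  have h4 := (h2.mul h3).mul_const (g ξ)
  refine HasFDerivAt.congr_fderiv h4 ?_
  ext v
  · simp [oscIntegrandDeriv, oscIntegrand, timeCLM, coordCLM]
    ring
  · simp [oscIntegrandDeriv, oscIntegrand, timeCLM, coordCLM, Finset.mul_sum]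
    exact Finset.sum_congr rfl fun i _ => by ring

theorem integrable_oscIntegrand (hcont : ∀ N, Continuous fun z : ℝ × E n => a N z.1 z.2)
    {K : Set (E n)} (hK : IsCompact K) (hsupp : ∀ N t ξ, ξ ∉ K → a N t ξ = 0)
    {g : E n → ℂ} (hg : Continuous g) (N : ℕ) (z : ℝ × E n) :
    Integrable (oscIntegrand a g N z) := by
  have hc : Continuous (oscIntegrand a g N z) :=
    (continuous_oscIntegrand hcont hg N).comp (f := fun ξ => (z, ξ)) (by fun_prop)
  refine hc.integrable_of_hasCompactSupport (HasCompactSupport.intro hK fun ξ hξ => ?_)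
  simp [oscIntegrand, hsupp N _ ξ hξ]

/-- Differentiation under the integral sign; the dominating function is a constant on `K`, from
compactness of the unit ball around `z` times `K`. -/
theorem hasFDerivAt_oscIntegral (hcont : ∀ N, Continuous fun z : ℝ × E n => a N z.1 z.2)
    (hderiv : ∀ N ξ t, HasDerivAt (fun t => a N t ξ) (Complex.I * a (N + 1) t ξ) t)
    {K : Set (E n)} (hK : IsCompact K) (hsupp : ∀ N t ξ, ξ ∉ K → a N t ξ = 0)
    {g : E n → ℂ} (hg : Continuous g) (N : ℕ) (z : ℝ × E n) :
    HasFDerivAt (oscIntegral a g N) ((Complex.I * oscIntegral a g (N + 1) z) • timeCLM n +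
      ∑ i, (Complex.I * oscIntegral a (fun ξ => ((ξ i : ℝ) : ℂ) * g ξ) N z) • coordCLM i) z := by
  have hgi : ∀ i : Fin n, Continuous fun ξ : E n => ((ξ i : ℝ) : ℂ) * g ξ := fun i => by fun_prop
  have hD : Continuous fun y : (ℝ × E n) × E n => oscIntegrandDeriv a g N y.1 y.2 := by
    unfold oscIntegrandDeriv
    refine ((continuous_const.mul (continuous_oscIntegrand hcont hg (N + 1))).smul
      continuous_const).add (continuous_finsetSum _ fun i _ => ?_)
    exact (continuous_const.mul (continuous_oscIntegrand hcont (hgi i) N)).smul continuous_const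
  obtain ⟨B, hB⟩ := ((isCompact_closedBall z 1).prod hK).exists_bound_of_continuousOn
    hD.continuousOn
  have hI1 := integrable_oscIntegrand hcont hK hsupp hg (N + 1) z
  have hI2 := fun i => integrable_oscIntegrand hcont hK hsupp (hgi i) N z
  have key := hasFDerivAt_integral_of_dominated_of_fderiv_le (μ := volume) (𝕜 := ℝ)
    (F := oscIntegrand a g N) (F' := oscIntegrandDeriv a g N) (x₀ := z)
    (bound := K.indicator fun _ => B) (Metric.closedBall_mem_nhds z one_pos)
    (.of_forall fun z => (integrable_oscIntegrand hcont hK hsupp hg N z).1)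
    (integrable_oscIntegrand hcont hK hsupp hg N z)
    (hD.comp (f := fun ξ => (z, ξ)) (by fun_prop)).aestronglyMeasurable
    (.of_forall fun ξ z' hz' => by
      by_cases hξ : ξ ∈ K
      · rw [Set.indicator_of_mem hξ]
        exact hB (z', ξ) ⟨hz', hξ⟩
      · rw [Set.indicator_of_notMem hξ]
        have h0 : oscIntegrandDeriv a g N z' ξ = 0 := by
          ext v <;> simp [oscIntegrandDeriv, oscIntegrand, hsupp _ _ ξ hξ]
        rw [h0, norm_zero])
    ((integrable_indicator_iff hK.measurableSet).mpr
      (integrableOn_const hK.measure_lt_top.ne))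
    (.of_forall fun ξ z' _ => hasFDerivAt_oscIntegrand hderiv g N ξ z')
  refine key.congr_fderiv ?_
  unfold oscIntegrandDeriv
  rw [integral_add ((hI1.const_mul _).smul_const _)
    (integrable_finsetSum _ fun i _ => ((hI2 i).const_mul _).smul_const _),
    integral_finsetSum _ fun i _ => ((hI2 i).const_mul _).smul_const _, integral_smul_const,
    integral_const_mul]
  congr 1
  refine Finset.sum_congr rfl fun i _ => ?_
  rw [integral_smul_const, integral_const_mul]
  rfl

/-- The family is closed under differentiation: `∂_t` raises `N` and `∂_{x_i}` multiplies `g` by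
`ξ_i`. Hence the induction runs over all `N` and `g` simultaneously. -/
theorem contDiff_oscIntegral (hcont : ∀ N, Continuous fun z : ℝ × E n => a N z.1 z.2)
    (hderiv : ∀ N ξ t, HasDerivAt (fun t => a N t ξ) (Complex.I * a (N + 1) t ξ) t)
    {K : Set (E n)} (hK : IsCompact K) (hsupp : ∀ N t ξ, ξ ∉ K → a N t ξ = 0)
    {g : E n → ℂ} (hg : Continuous g) (N : ℕ) : ContDiff ℝ ∞ (oscIntegral a g N) := by
  rw [contDiff_infty]
  intro k
  induction k generalizing g N with
  | zero =>
    refine contDiff_zero.mpr (continuous_iff_continuousAt.mpr fun z => ?_)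
    exact (hasFDerivAt_oscIntegral hcont hderiv hK hsupp hg N z).continuousAt
  | succ k ih =>
    push_cast
    refine contDiff_succ_iff_hasFDerivAt.mpr
      ⟨_, ?_, hasFDerivAt_oscIntegral hcont hderiv hK hsupp hg N⟩
    refine ((contDiff_const.mul (ih hg (N + 1))).smul contDiff_const).add
      (ContDiff.sum fun i _ => ?_)
    exact (contDiff_const.mul (ih (by fun_prop) N)).smul contDiff_const

theorem Dx1_oscIntegral (hcont : ∀ N, Continuous fun z : ℝ × E n => a N z.1 z.2)
    (hderiv : ∀ N ξ t, HasDerivAt (fun t => a N t ξ) (Complex.I * a (N + 1) t ξ) t)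
    {K : Set (E n)} (hK : IsCompact K) (hsupp : ∀ N t ξ, ξ ∉ K → a N t ξ = 0)
    {g : E n → ℂ} (hg : Continuous g) (N : ℕ) (t : ℝ) (i : Fin n) :
    Dx1 i (fun x => oscIntegral a g N (t, x)) =
      fun x => oscIntegral a (fun ξ => ((ξ i : ℝ) : ℂ) * g ξ) N (t, x) := by
  ext x
  have h := (hasFDerivAt_oscIntegral hcont hderiv hK hsupp hg N (t, x)).comp x
    (hasFDerivAt_prodMk_right (𝕜 := ℝ) t x)
  have h' : fderiv ℝ (fun x => oscIntegral a g N (t, x)) x = _ := h.fderiv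
  rw [Dx1, h']
  simp only [timeCLM, coordCLM, ContinuousLinearMap.comp_apply, add_apply, sum_apply, smul_apply,
    ContinuousLinearMap.inr_apply, ContinuousLinearMap.coe_fst', ContinuousLinearMap.coe_snd',
    Complex.ofRealCLM_apply, PiLp.proj_apply, PiLp.single_apply, apply_ite Complex.ofReal,
    smul_eq_mul, Complex.ofReal_zero, Complex.ofReal_one, mul_ite, mul_zero, mul_one,
    Finset.sum_ite_eq', Finset.mem_univ, if_true, zero_add]
  field_simp

theorem Dx1_iterate_oscIntegral (hcont : ∀ N, Continuous fun z : ℝ × E n => a N z.1 z.2)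
    (hderiv : ∀ N ξ t, HasDerivAt (fun t => a N t ξ) (Complex.I * a (N + 1) t ξ) t)
    {K : Set (E n)} (hK : IsCompact K) (hsupp : ∀ N t ξ, ξ ∉ K → a N t ξ = 0)
    {g : E n → ℂ} (hg : Continuous g) (N : ℕ) (t : ℝ) (i : Fin n) (r : ℕ) :
    (Dx1 i)^[r] (fun x => oscIntegral a g N (t, x)) =
      fun x => oscIntegral a (fun ξ => ((ξ i : ℝ) : ℂ) ^ r * g ξ) N (t, x) := by
  induction r with
  | zero => simp
  | succ r ih =>
    rw [Function.iterate_succ_apply', ih,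
      Dx1_oscIntegral hcont hderiv hK hsupp (by fun_prop)]
    simp_rw [← mul_assoc, ← pow_succ']

theorem Dx_oscIntegral (hcont : ∀ N, Continuous fun z : ℝ × E n => a N z.1 z.2)
    (hderiv : ∀ N ξ t, HasDerivAt (fun t => a N t ξ) (Complex.I * a (N + 1) t ξ) t)
    {K : Set (E n)} (hK : IsCompact K) (hsupp : ∀ N t ξ, ξ ∉ K → a N t ξ = 0)
    {g : E n → ℂ} (hg : Continuous g) (N : ℕ) (t : ℝ) (α : Fin n → ℕ) :
    Dx α (fun x => oscIntegral a g N (t, x)) =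
      fun x => oscIntegral a (fun ξ => monom α ξ * g ξ) N (t, x) := by
  have key : ∀ l : List (Fin n),
      l.foldr (fun i h => (Dx1 i)^[α i] h) (fun x => oscIntegral a g N (t, x)) =
      fun x => oscIntegral a (fun ξ => (l.map fun i => ((ξ i : ℝ) : ℂ) ^ α i).prod * g ξ) N
        (t, x) := by
    intro l
    induction l with
    | nil => simp
    | cons i l ih =>
      have hc : Continuous fun ξ : E n => (l.map fun i => ((ξ i : ℝ) : ℂ) ^ α i).prod :=
        continuous_list_prod _ fun i _ => by fun_prop
      rw [List.foldr_cons, ih,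
        Dx1_iterate_oscIntegral hcont hderiv hK hsupp
          (g := fun ξ => (l.map fun i => ((ξ i : ℝ) : ℂ) ^ α i).prod * g ξ) (by fun_prop)]
      simp_rw [List.map_cons, List.prod_cons, mul_assoc]
  rw [Dx, key]
  simp_rw [monom, Fin.prod_univ_def]

theorem Dt_oscIntegral (hcont : ∀ N, Continuous fun z : ℝ × E n => a N z.1 z.2)
    (hderiv : ∀ N ξ t, HasDerivAt (fun t => a N t ξ) (Complex.I * a (N + 1) t ξ) t)
    {K : Set (E n)} (hK : IsCompact K) (hsupp : ∀ N t ξ, ξ ∉ K → a N t ξ = 0)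
    {g : E n → ℂ} (hg : Continuous g) (r : ℕ) (t : ℝ) (x : E n) :
    Dt r (fun t => oscIntegral a g 0 (t, x)) t = oscIntegral a g r (t, x) := by
  induction r generalizing t with
  | zero => simp [Dt]
  | succ r ih =>
    have h := (hasFDerivAt_oscIntegral hcont hderiv hK hsupp hg r (t, x)).comp_hasDerivAt t
      ((hasDerivAt_id t).prodMk (hasDerivAt_const t x))
    have h' : deriv (fun t => oscIntegral a g r (t, x)) t = _ := h.deriv
    have h0 : deriv (Dt r fun t => oscIntegral a g 0 (t, x)) t =
        (1 / Complex.I) ^ r * deriv (iteratedDeriv r fun t => oscIntegral a g 0 (t, x)) t :=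
      deriv_const_mul_field _
    rw [funext ih, h'] at h0
    rw [Dt, iteratedDeriv_succ, pow_succ', mul_assoc, ← h0]
    simp [timeCLM, coordCLM, ← mul_assoc]

end Oscillatory

end HypDecay
end

/-! ### Fourier multipliers between dual Lebesgue spaces. -/

noncomputable section
namespace HypDecay
open MeasureTheory

/-- The Fourier multiplier with symbol `b`, without normalizing constant. -/
def fourierMultiplier {n : ℕ} (b f : E n → ℂ) (x : E n) : ℂ := fhat (fun ξ => b ξ * fhat f ξ) (-x)

section Multiplier

variable {n : ℕ} {b : E n → ℂ}

theorem continuous_mul_fhat (hb : Continuous b) {f : E n → ℂ} (hf : Integrable f) :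
    Continuous fun ξ => b ξ * fhat f ξ := hb.mul (continuous_fhat hf)

theorem hasCompactSupport_mul_fhat (hbc : HasCompactSupport b) (f : E n → ℂ) :
    HasCompactSupport fun ξ => b ξ * fhat f ξ := hbc.mul_right

theorem integrable_mul_fhat (hb : Continuous b) (hbc : HasCompactSupport b) {f : E n → ℂ}
    (hf : Integrable f) : Integrable fun ξ => b ξ * fhat f ξ :=
  (continuous_mul_fhat hb hf).integrable_of_hasCompactSupport (hasCompactSupport_mul_fhat hbc f)

theorem fourierMultiplier_add (hb : Continuous b) (hbc : HasCompactSupport b) {f g : E n → ℂ}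
    (hf : Integrable f) (hg : Integrable g) :
    fourierMultiplier b (f + g) = fourierMultiplier b f + fourierMultiplier b g := by
  have : (fun ξ => b ξ * fhat (f + g) ξ) =
      (fun ξ => b ξ * fhat f ξ) + fun ξ => b ξ * fhat g ξ := by
    rw [fhat_add hf hg]
    ext ξ
    simp [mul_add]
  ext x
  rw [fourierMultiplier, this,
    fhat_add (integrable_mul_fhat hb hbc hf) (integrable_mul_fhat hb hbc hg)]
  rfl

theorem continuous_fourierMultiplier (hb : Continuous b) (hbc : HasCompactSupport b)
    {f : E n → ℂ} (hf : Integrable f) : Continuous (fourierMultiplier b f) :=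
  (continuous_fhat (integrable_mul_fhat hb hbc hf)).comp continuous_neg

theorem enorm_fourierMultiplier_le {A : ℝ} (hA : ∫⁻ ξ, ‖b ξ‖ₑ ≤ ENNReal.ofReal A)
    {f : E n → ℂ} (hf : Integrable f) (x : E n) :
    ‖fourierMultiplier b f x‖ₑ ≤ ENNReal.ofReal A * eLpNorm f 1 volume := by
  refine (enorm_fhat_le _ _).trans ?_
  rw [eLpNorm_one_eq_lintegral_enorm]
  calc ∫⁻ ξ, ‖b ξ * fhat f ξ‖ₑ ≤ ∫⁻ ξ, ‖b ξ‖ₑ * eLpNorm f 1 volume := by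
        refine lintegral_mono fun ξ => ?_
        rw [enorm_mul]
        gcongr
        exact enorm_fhat_le f ξ
    _ ≤ _ := by
        rw [lintegral_mul_const' _ _ (memLp_one_iff_integrable.mpr hf).2.ne]
        gcongr

/-- Plancherel is used twice, once for each transform, whence `c²`. -/
theorem eLpNorm_two_fourierMultiplier_le {c : ℝ} (hc : 0 < c)
    (hfhat : ∀ f : E n → ℂ, Integrable f → MemLp f 2 →
      eLpNorm (fhat f) 2 volume ≤ ENNReal.ofReal c * eLpNorm f 2 volume)
    (hb : Continuous b) (hbc : HasCompactSupport b) {B : ℝ} (hB : ∀ ξ, ‖b ξ‖ ≤ B)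
    {f : E n → ℂ} (hf : Integrable f) (hf2 : MemLp f 2) :
    eLpNorm (fourierMultiplier b f) 2 volume ≤
      ENNReal.ofReal (c ^ 2 * B) * eLpNorm f 2 volume := by
  have hB0 : 0 ≤ B := (norm_nonneg _).trans (hB 0)
  have h1 : eLpNorm (fourierMultiplier b f) 2 volume =
      eLpNorm (fhat fun ξ => b ξ * fhat f ξ) 2 volume :=
    eLpNorm_comp_measurePreserving
      (continuous_fhat (integrable_mul_fhat hb hbc hf)).aestronglyMeasurable
      (Measure.measurePreserving_neg volume)
  have h2 : MemLp (fun ξ => b ξ * fhat f ξ) 2 :=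
    (continuous_mul_fhat hb hf).memLp_of_hasCompactSupport (hasCompactSupport_mul_fhat hbc f)
  calc _ ≤ ENNReal.ofReal c * eLpNorm (fun ξ => b ξ * fhat f ξ) 2 volume := by
        rw [h1]; exact hfhat _ (integrable_mul_fhat hb hbc hf) h2
    _ ≤ ENNReal.ofReal c * (ENNReal.ofReal B * eLpNorm (fhat f) 2 volume) := by
        gcongr
        refine eLpNorm_le_mul_eLpNorm_of_ae_le_mul (.of_forall fun ξ => ?_) 2
        rw [norm_mul]
        gcongr
        exact hB ξ
    _ ≤ ENNReal.ofReal c * (ENNReal.ofReal B * (ENNReal.ofReal c * eLpNorm f 2 volume)) := by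
        gcongr
        exact hfhat f hf hf2
    _ = _ := by
        rw [← mul_assoc, ← mul_assoc, ← ENNReal.ofReal_mul hc.le,
          ← ENNReal.ofReal_mul (by positivity)]
        ring_nf

end Multiplier

/-- `L^p → L^{p'}` bounds for Fourier multipliers in terms of the `L¹` and `L^∞` norms of the
symbol. -/
theorem exists_eLpNorm_fourierMultiplier_le (n : ℕ) {p q : ℝ≥0∞} (hp1 : 1 ≤ p) (hp2 : p ≤ 2)
    (hpq : p⁻¹ + q⁻¹ = 1) :
    ∃ C : ℝ, 0 < C ∧ ∀ (b : E n → ℂ) (A B : ℝ), Continuous b → HasCompactSupport b → 0 < A →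
      0 < B → ∫⁻ ξ, ‖b ξ‖ₑ ≤ ENNReal.ofReal A → (∀ ξ, ‖b ξ‖ ≤ B) →
      ∀ f : E n → ℂ, Continuous f → HasCompactSupport f →
        eLpNorm (fourierMultiplier b f) q volume ≤
          ENNReal.ofReal (C * (A ^ ((p⁻¹).toReal - (q⁻¹).toReal) *
            B ^ (1 - ((p⁻¹).toReal - (q⁻¹).toReal)))) * eLpNorm f p volume := by
  obtain ⟨c, hc, hfhat⟩ := exists_eLpNorm_fhat_le n
  have hp0 : p ≠ 0 := (zero_lt_one.trans_le hp1).ne'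
  have hpt : p ≠ ⊤ := (hp2.trans_lt (by norm_num)).ne
  have hsum : (p⁻¹).toReal + (q⁻¹).toReal = 1 := by
    rw [← ENNReal.toReal_add (ENNReal.inv_ne_top.mpr hp0), hpq, ENNReal.toReal_one]
    exact ne_top_of_le_ne_top ENNReal.one_ne_top (hpq ▸ le_add_self)
  rcases hp1.eq_or_lt with rfl | hp1
  · refine ⟨1, one_pos, fun b A B hb hbc hA hB hbA hbB f hf hfc => ?_⟩
    have hq : q⁻¹ = 0 := by
      rw [inv_one] at hpq
      exact (ENNReal.add_right_inj ENNReal.one_ne_top).mp (by rw [hpq, add_zero])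
    rw [ENNReal.inv_eq_zero.mp hq]
    simp only [inv_one, ENNReal.toReal_one, ENNReal.inv_top, ENNReal.toReal_zero, sub_zero,
      Real.rpow_one, sub_self, Real.rpow_zero, mul_one, one_mul]
    rw [eLpNorm_exponent_top]
    exact eLpNormEssSup_le_of_ae_enorm_bound
      (.of_forall fun x => enorm_fourierMultiplier_le hbA (hf.integrable_of_hasCompactSupport hfc) x)
  -- The endpoint `p = 2` is separate because the interpolation constant has `q - 2` in a
  -- denominator.
  rcases hp2.eq_or_lt with rfl | hp2
  · refine ⟨c ^ 2, by positivity, fun b A B hb hbc hA hB hbA hbB f hf hfc => ?_⟩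
    have hq : q = 2 := by
      have h2 : (2 : ℝ≥0∞)⁻¹ + 2⁻¹ = 1 := ENNReal.inv_two_add_inv_two
      rw [← h2] at hpq
      exact inv_injective ((ENNReal.add_right_inj (by norm_num)).mp hpq)
    subst hq
    simp only [sub_self, Real.rpow_zero, sub_zero, Real.rpow_one, one_mul]
    exact eLpNorm_two_fourierMultiplier_le hc hfhat hb hbc hbB
      (hf.integrable_of_hasCompactSupport hfc) (hf.memLp_of_hasCompactSupport hfc)
  have hpr : 1 < p.toReal := by
    rw [← ENNReal.toReal_one]; exact (ENNReal.toReal_lt_toReal (by norm_num) hpt).mpr hp1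
  have hpr2 : p.toReal < 2 := by
    rw [← ENNReal.toReal_ofNat]; exact (ENNReal.toReal_lt_toReal hpt (by norm_num)).mpr hp2
  have hqt : q ≠ ⊤ := by
    rintro rfl
    rw [ENNReal.inv_top, add_zero, ENNReal.inv_eq_one] at hpq
    exact hp1.ne' hpq
  have hconj : p.toReal.HolderConjugate q.toReal := by
    rw [Real.holderConjugate_iff]
    exact ⟨hpr, by rw [← ENNReal.toReal_inv, ← ENNReal.toReal_inv, hsum]⟩
  have hq2 : 2 < q.toReal := by
    have h1 := hconj.inv_add_inv_eq_one
    have h2 : (2 : ℝ)⁻¹ < p.toReal⁻¹ := inv_strictAnti₀ hconj.pos hpr2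
    exact (inv_lt_inv₀ hconj.symm.pos (by norm_num)).mp (by norm_num at *; linarith)
  rw [ENNReal.toReal_inv, ENNReal.toReal_inv]
  set pr := p.toReal
  set qr := q.toReal
  have hqr := sub_pos.mpr hq2
  have hqr0 := hconj.symm.pos
  set C := (4 * qr * 2 ^ (qr - 2) / (qr - 2)) ^ (1 / qr) with hC
  refine ⟨C * (c ^ 2) ^ (1 - (pr⁻¹ - qr⁻¹)), by positivity,
    fun b A B hb hbc hA hB hbA hbB f hf hfc => ?_⟩
  have key := eLpNorm_le_of_one_top_of_two_two (μ := (volume : Measure (E n)))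
    (ν := (volume : Measure (E n))) (T := fourierMultiplier b) (A := A) (B := c ^ 2 * B)
    (fun g h hg hh => fourierMultiplier_add hb hbc hg hh)
    (fun g hg => (continuous_fourierMultiplier hb hbc hg).aestronglyMeasurable)
    (fun g hg y => enorm_fourierMultiplier_le hbA hg y)
    (fun g hg hg2 => eLpNorm_two_fourierMultiplier_le hc hfhat hb hbc hbB hg hg2)
    hA (by positivity) hconj hpr2 hf.measurable (hf.integrable_of_hasCompactSupport hfc)
    (hf.memLp_of_hasCompactSupport hfc) (hf.memLp_of_hasCompactSupport hfc)
  rw [ENNReal.ofReal_toReal hpt, ENNReal.ofReal_toReal hqt,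
    Real.mul_rpow (by positivity) hB.le] at key
  refine key.trans (le_of_eq ?_)
  rw [← hC]
  congr 2
  ring

end HypDecay
end

/-! ### Symbol bounds and the decay estimate. -/

noncomputable section
namespace HypDecay
open MeasureTheory analyticFun

theorem mem_firstRoots {m L : ℕ} {k : Fin m} : k ∈ firstRoots m L ↔ k.val < L := by
  simp [firstRoots]

theorem card_firstRoots {m L : ℕ} (h : L ≤ m) : (firstRoots m L).card = L := by
  rw [firstRoots, Fin.card_filter_val_lt, min_eq_right h]

/-- The amplitude `D_t^N (∑_{k ∈ S} e^{i τ_k(ξ) t} A_j^k(t,ξ)) χ(ξ)`. -/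
def cutoffAmplitude {n m : ℕ} (τ : Fin m → E n → ℂ) (A : Fin m → Fin m → E n → Polynomial ℂ)
    (S : Finset (Fin m)) (j : Fin m) (χ : E n → ℂ) (N : ℕ) (t : ℝ) (ξ : E n) : ℂ :=
  ((D ^ N) (groupFun τ A S j ξ)).1 t * χ ξ

section

variable {n m : ℕ} {O : ConstCoeffOp n m} {τ : Fin m → E n → ℂ}
  {A : Fin m → Fin m → E n → Polynomial ℂ} {χ : E n → ℂ} {S : Finset (Fin m)} {j : Fin m}

theorem hasDerivAt_cutoffAmplitude (N : ℕ) (ξ : E n) (t : ℝ) :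
    HasDerivAt (fun t => cutoffAmplitude τ A S j χ N t ξ)
      (Complex.I * cutoffAmplitude τ A S j χ (N + 1) t ξ) t := by
  have h := (analyticFun.hasDerivAt ((D ^ N) (groupFun τ A S j ξ)) t).mul_const (χ ξ)
  rw [← Module.End.mul_apply, ← pow_succ', mul_assoc] at h
  exact h

theorem cutoffAmplitude_eq_zero {N : ℕ} {t : ℝ} {ξ : E n} (h : ξ ∉ tsupport χ) :
    cutoffAmplitude τ A S j χ N t ξ = 0 := by
  rw [cutoffAmplitude, image_eq_zero_of_notMem_tsupport h, mul_zero]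

/-- Nothing is known about the group sum outside `V`; the support of `χ` inside `V` makes the
product continuous everywhere. -/
theorem continuous_cutoffAmplitude (hτ : O.IsCharRoots τ) (hA : O.IsAmplitudes τ A)
    {V : Set (E n)} (hV : IsOpen V)
    (hcont : ∀ z : ℂ, ContinuousOn (fun ξ => ∏ k ∈ S, (z - τ k ξ)) V)
    (hsep : ∀ ξ ∈ V, ∀ k ∈ S, ∀ k' ∈ Sᶜ, τ k ξ ≠ τ k' ξ)
    (hχ : Continuous χ) (hχV : tsupport χ ⊆ V) (N : ℕ) :
    Continuous fun z : ℝ × E n => cutoffAmplitude τ A S j χ N z.1 z.2 := by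
  refine ContinuousOn.continuous_of_tsupport_subset (s := Set.univ ×ˢ V)
    ((continuousOn_D_pow_groupFun hτ hA S j hcont hsep N).mul (by fun_prop))
    (isOpen_univ.prod hV) ?_
  have hclosed : IsClosed ((Set.univ : Set ℝ) ×ˢ tsupport χ) :=
    isClosed_univ.prod (isClosed_tsupport χ)
  have hsub : Function.support (fun z : ℝ × E n => cutoffAmplitude τ A S j χ N z.1 z.2) ⊆
      (Set.univ : Set ℝ) ×ˢ tsupport χ := by
    refine fun z hz => ⟨Set.mem_univ _, ?_⟩
    by_contra h
    exact hz (cutoffAmplitude_eq_zero h)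
  exact (closure_minimal hsub hclosed).trans (Set.prod_mono le_rfl hχV)

theorem groupIntegrand_eq_oscIntegrand (L : ℕ) (f : E n → ℂ) (t : ℝ) (x ξ : E n) :
    groupIntegrand τ A L χ j f t x ξ =
      oscIntegrand (cutoffAmplitude τ A (firstRoots m L) j χ) (fhat f) 0 (t, x) ξ := by
  simp only [groupIntegrand, oscIntegrand, cutoffAmplitude, pow_zero, Module.End.one_apply,
    groupFun_coe]
  ring

theorem groupPart_eq_oscIntegral (L : ℕ) {V : Set (E n)} (hχV : tsupport χ ⊆ V) (f : E n → ℂ)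
    (t : ℝ) (x : E n) : groupPart τ A L V χ j f t x =
      oscIntegral (cutoffAmplitude τ A (firstRoots m L) j χ) (fhat f) 0 (t, x) := by
  rw [groupPart, oscIntegral]
  simp_rw [groupIntegrand_eq_oscIntegrand]
  refine setIntegral_eq_integral_of_forall_compl_eq_zero fun ξ hξ => ?_
  simp [oscIntegrand, cutoffAmplitude_eq_zero fun h => hξ (hχV h)]

theorem oscIntegral_eq_fourierMultiplier (a : ℕ → ℝ → E n → ℂ) (w f : E n → ℂ) (N : ℕ) (t : ℝ)
    (x : E n) : oscIntegral a (fun ξ => w ξ * fhat f ξ) N (t, x) =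
      fourierMultiplier (fun ξ => a N t ξ * w ξ) f x := by
  rw [oscIntegral, fourierMultiplier, fhat]
  refine integral_congr_ae (.of_forall fun ξ => ?_)
  simp only [oscIntegrand, inner_neg_right, real_inner_comm]
  push_cast
  ring_nf

/-- Pointwise bound of the symbol of `D_t^r D_x^α` applied to the group part. -/
theorem exists_norm_cutoffAmplitude_mul_le (hτ : O.IsCharRoots τ) (hA : O.IsAmplitudes τ A)
    {V : Set (E n)} (hcont : ∀ z : ℂ, ContinuousOn (fun ξ => ∏ k ∈ S, (z - τ k ξ)) V)
    (hsep : ∀ ξ ∈ V, ∀ k ∈ S, ∀ k' ∈ Sᶜ, τ k ξ ≠ τ k' ξ) {d : E n → ℝ} {κ : ℝ}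
    (hd : ∀ ξ ∈ V, d ξ ≤ κ) (him : ∀ ξ ∈ V, ∀ k ∈ S, d ξ ≤ (τ k ξ).im)
    (hχ : Continuous χ) (hχc : HasCompactSupport χ) (hχV : tsupport χ ⊆ V)
    {w : E n → ℂ} (hw : Continuous w) (N : ℕ) :
    ∃ B : ℝ, 0 < B ∧ ∀ t : ℝ, 0 ≤ t → ∀ ξ ∈ V, ‖cutoffAmplitude τ A S j χ N t ξ * w ξ‖ ≤
      B * japanese t ^ (S.card - 1) * Real.exp (-(d ξ * japanese t)) := by
  obtain ⟨B, hB0, hB⟩ := exists_norm_D_pow_groupFun_le hτ hA S j hχc.isCompact hχV hcont hsep him N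
  obtain ⟨M, hM⟩ := hχc.isCompact.exists_bound_of_continuousOn (hχ.mul hw).continuousOn
  -- Cost of replacing `t` by `⟨t⟩`: `1 + t ≤ 2⟨t⟩` gives the power of `2`, and `⟨t⟩ - t ≤ 1` with
  -- `d ≤ κ` gives `e^{|κ|}`. Then `|M|` bounds `χ w`, and `1` ensures positivity.
  refine ⟨B * 2 ^ (S.card - 1) * Real.exp |κ| * |M| + 1, by positivity, fun t ht ξ hξ => ?_⟩
  have hj := one_le_japanese t
  have hj' := japanese_le_one_add ht
  have hjt := le_japanese t
  have hpos : 0 < japanese t ^ (S.card - 1) * Real.exp (-(d ξ * japanese t)) := by positivity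
  by_cases hξK : ξ ∈ tsupport χ
  · have h1 : (1 + t) ^ (S.card - 1) ≤ 2 ^ (S.card - 1) * japanese t ^ (S.card - 1) := by
      rw [← mul_pow]; gcongr; linarith
    have h2 : Real.exp (-(d ξ * t)) ≤ Real.exp |κ| * Real.exp (-(d ξ * japanese t)) := by
      rw [← Real.exp_add]
      apply Real.exp_le_exp.mpr
      have e : d ξ * (japanese t - t) ≤ |κ| := by
        calc d ξ * (japanese t - t) ≤ |κ| * (japanese t - t) := by
              have := (hd ξ hξ).trans (le_abs_self κ)
              have : 0 ≤ japanese t - t := by linarith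
              gcongr
          _ ≤ |κ| * 1 := by gcongr; linarith
          _ = |κ| := mul_one _
      linarith
    have h3 : ‖χ ξ * w ξ‖ ≤ |M| := (hM ξ hξK).trans (le_abs_self M)
    calc ‖cutoffAmplitude τ A S j χ N t ξ * w ξ‖
        = ‖((D ^ N) (groupFun τ A S j ξ)).1 t‖ * ‖χ ξ * w ξ‖ := by
          rw [cutoffAmplitude, mul_assoc, norm_mul]
      _ ≤ (B * (2 ^ (S.card - 1) * japanese t ^ (S.card - 1)) *
            (Real.exp |κ| * Real.exp (-(d ξ * japanese t)))) * |M| := by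
          gcongr
          refine (hB ξ hξK t ht).trans ?_
          gcongr
      _ ≤ _ := by linarith
  · rw [cutoffAmplitude_eq_zero hξK, zero_mul, norm_zero]
    positivity

end

end HypDecay

end

theorem mainTheorem9 {n m : ℕ}
    (O : HypDecay.ConstCoeffOp n m) (hO : O.StrictlyHyperbolic)
    (τ : Fin m → HypDecay.E n → ℂ) (hτ : O.IsCharRoots τ)
    (A : Fin m → Fin m → HypDecay.E n → Polynomial ℂ) (hA : O.IsAmplitudes τ A)
    (L : ℕ) (hL1 : 1 ≤ L) (hLm : L ≤ m)
    (M : Set (HypDecay.E n)) (hMb : Bornology.IsBounded M)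
    (l : ℕ) (hM : HypDecay.HasCodim M l)
    (ε : ℝ) (hε : 0 < ε)
    -- the unordered `L`-tuple `τ₁(ξ), …, τ_L(ξ)` depends continuously on `ξ ∈ M^ε`
    (hcont : ∀ z : ℂ, ContinuousOn
      (fun ξ => ∏ k ∈ HypDecay.firstRoots m L, (z - τ k ξ)) (Metric.thickening ε M))
    -- `τ₁, …, τ_L` do not intersect `τ_{L+1}, …, τ_m` in `M^ε`
    (hsep : ∀ ξ ∈ Metric.thickening ε M, ∀ k k' : Fin m, k.val < L → L ≤ k'.val →
      τ k ξ ≠ τ k' ξ)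
    (s c₀ : ℝ) (hs : 0 < s) (hc₀ : 0 < c₀)
    (him : ∀ ξ ∈ Metric.thickening ε M, ∀ k : Fin m, k.val < L →
      c₀ * Metric.infDist ξ M ^ s ≤ (τ k ξ).im)
    (χ : HypDecay.E n → ℂ) (hχ : ContDiff ℝ ∞ χ) (hχc : HasCompactSupport χ)
    (hχs : tsupport χ ⊆ Metric.thickening ε M)
    (j : Fin m) :
    -- the integral converges absolutely and defines a smooth function of `(t, x)`
    (∀ f : HypDecay.E n → ℂ, ContDiff ℝ ∞ f → HasCompactSupport f →
      (∀ (t : ℝ) (x : HypDecay.E n), MeasureTheory.IntegrableOn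
        (HypDecay.groupIntegrand τ A L χ j f t x) (Metric.thickening ε M)) ∧
      ContDiff ℝ ∞ (fun z : ℝ × HypDecay.E n =>
        HypDecay.groupPart τ A L (Metric.thickening ε M) χ j f z.1 z.2)) ∧
    -- the decay estimate
    ∀ (r : ℕ) (α : Fin n → ℕ) (p q : ℝ≥0∞), 1 ≤ p → p ≤ 2 → p⁻¹ + q⁻¹ = 1 →
      ∃ C : ℝ, 0 < C ∧ ∀ t : ℝ, 0 ≤ t →
        ∀ f : HypDecay.E n → ℂ, ContDiff ℝ ∞ f → HasCompactSupport f →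
          MeasureTheory.eLpNorm
            (fun x => HypDecay.Dt r (fun t' => HypDecay.Dx α
              (HypDecay.groupPart τ A L (Metric.thickening ε M) χ j f t') x) t)
            q MeasureTheory.volume
          ≤ ENNReal.ofReal (C * HypDecay.japanese t ^
              (-((l : ℝ) / s) * ((p⁻¹).toReal - (q⁻¹).toReal) + ((L : ℝ) - 1))) *
            MeasureTheory.eLpNorm f p MeasureTheory.volume := by
  open MeasureTheory HypDecay in
  have hMne := hM.nonempty
  set V := Metric.thickening ε M with hV
  set S := firstRoots m L with hS
  set a := cutoffAmplitude τ A S j χ with ha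
  have hVo : IsOpen V := Metric.isOpen_thickening
  have hsep' : ∀ ξ ∈ V, ∀ k ∈ S, ∀ k' ∈ Sᶜ, τ k ξ ≠ τ k' ξ := fun ξ hξ k hk k' hk' =>
    hsep ξ hξ k k' (mem_firstRoots.mp hk)
      (not_lt.mp fun h => Finset.mem_compl.mp hk' (mem_firstRoots.mpr h))
  have him' : ∀ ξ ∈ V, ∀ k ∈ S, c₀ * Metric.infDist ξ M ^ s ≤ (τ k ξ).im := fun ξ hξ k hk =>
    him ξ hξ k (mem_firstRoots.mp hk)
  have hacont : ∀ N, Continuous fun z : ℝ × E n => a N z.1 z.2 :=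
    continuous_cutoffAmplitude hτ hA hVo hcont hsep' hχ.continuous hχs
  have haderiv : ∀ N ξ t, HasDerivAt (fun t => a N t ξ) (Complex.I * a (N + 1) t ξ) t :=
    hasDerivAt_cutoffAmplitude
  have hasupp : ∀ N t ξ, ξ ∉ tsupport χ → a N t ξ = 0 := fun N t ξ h => cutoffAmplitude_eq_zero h
  have hK : IsCompact (tsupport χ) := hχc.isCompact
  have hfhat : ∀ f : E n → ℂ, ContDiff ℝ ∞ f → HasCompactSupport f → Continuous (fhat f) :=
    fun f hf hfc => continuous_fhat (hf.continuous.integrable_of_hasCompactSupport hfc)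
  refine ⟨fun f hf hfc => ⟨fun t x => ?_, ?_⟩, ?_⟩
  · have h := (integrable_oscIntegrand hacont hK hasupp (hfhat f hf hfc) 0 (t, x)).integrableOn
      (s := V)
    exact h.congr (.of_forall fun ξ => (groupIntegrand_eq_oscIntegrand L f t x ξ).symm)
  · simp_rw [groupPart_eq_oscIntegral L hχs]
    exact contDiff_oscIntegral hacont haderiv hK hasupp (hfhat f hf hfc) 0
  intro r α p q hp1 hp2 hpq
  have hd : ∀ ξ ∈ V, c₀ * Metric.infDist ξ M ^ s ≤ c₀ * ε ^ s := by
    intro ξ hξ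
    have : Metric.infDist ξ M < ε := by
      obtain ⟨y, hy, hxy⟩ := Metric.mem_thickening_iff.mp hξ
      exact (Metric.infDist_lt_iff hMne).mpr ⟨y, hy, hxy⟩
    have h0 := Metric.infDist_nonneg (x := ξ) (s := M)
    gcongr
  obtain ⟨B, hB0, hB⟩ := exists_norm_cutoffAmplitude_mul_le (j := j) hτ hA hcont hsep' hd him'
    hχ.continuous hχc hχs (continuous_monom α) r
  obtain ⟨K, hKV⟩ := hM.exists_volume_le hMb ε
  obtain ⟨C₁, hC₁0, hC₁⟩ := lintegral_exp_neg_infDist_le volume M l hc₀ hs V hKV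
  obtain ⟨C₂, hC₂0, hC₂⟩ := exists_eLpNorm_fourierMultiplier_le n hp1 hp2 hpq
  set θ := (p⁻¹).toReal - (q⁻¹).toReal with hθ
  refine ⟨C₂ * (B * C₁ ^ θ), by positivity, fun t ht f hf hfc => ?_⟩
  have hJ := japanese_pos t
  have hfun : (fun x => Dt r (fun t' => Dx α (groupPart τ A L V χ j f t') x) t) =
      fourierMultiplier (fun ξ => a r t ξ * monom α ξ) f := by
    ext x
    have h1 : ∀ t', groupPart τ A L V χ j f t' = fun x => oscIntegral a (fhat f) 0 (t', x) :=
      fun t' => funext fun x => groupPart_eq_oscIntegral L hχs f t' x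
    simp_rw [h1, Dx_oscIntegral hacont haderiv hK hasupp (hfhat f hf hfc)]
    rw [Dt_oscIntegral hacont haderiv hK hasupp (g := fun ξ => monom α ξ * fhat f ξ)
        ((continuous_monom α).mul (hfhat f hf hfc)),
      oscIntegral_eq_fourierMultiplier]
  rw [hfun]
  have hbc : Continuous fun ξ => a r t ξ * monom α ξ :=
    ((hacont r).comp (f := fun ξ => (t, ξ)) (by fun_prop)).mul (continuous_monom α)
  have hbs : HasCompactSupport fun ξ => a r t ξ * monom α ξ :=
    HasCompactSupport.intro hK fun ξ hξ => by rw [hasupp r t ξ hξ, zero_mul]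
  have hb0 : ∀ ξ, ξ ∉ V → a r t ξ * monom α ξ = 0 := fun ξ hξ => by
    rw [hasupp r t ξ fun h => hξ (hχs h), zero_mul]
  have hcard : S.card = L := card_firstRoots hLm
  rw [hcard] at hB
  -- Bounds the symbol in supremum, since the exponential factor is at most `1`; its L¹ norm gains
  -- `C₁⟨t⟩^{-l/s}`. The slicing estimate needs a positive time, which `⟨t⟩` is even at `t = 0`.
  set X := B * japanese t ^ (L - 1) with hX
  have hX0 : 0 < X := by positivity
  have hsup : ∀ ξ, ‖a r t ξ * monom α ξ‖ ≤ X := by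
    intro ξ
    by_cases hξ : ξ ∈ V
    · refine (hB t ht ξ hξ).trans (mul_le_of_le_one_right hX0.le ?_)
      rw [Real.exp_le_one_iff, neg_nonpos]
      have h0 := Metric.infDist_nonneg (x := ξ) (s := M)
      positivity
    · rw [hb0 ξ hξ, norm_zero]
      exact hX0.le
  have hint : ∫⁻ ξ, ‖a r t ξ * monom α ξ‖ₑ ≤
      ENNReal.ofReal (X * (C₁ * japanese t ^ (-((l : ℝ) / s)))) := by
    calc ∫⁻ ξ, ‖a r t ξ * monom α ξ‖ₑ = ∫⁻ ξ in V, ‖a r t ξ * monom α ξ‖ₑ := by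
          rw [setLIntegral_eq_of_support_subset]
          intro ξ hξ
          by_contra h
          exact hξ (by simp [hb0 ξ h])
      _ ≤ ∫⁻ ξ in V, ENNReal.ofReal X *
            ENNReal.ofReal (Real.exp (-(c₀ * (japanese t * Metric.infDist ξ M ^ s)))) := by
          refine setLIntegral_mono' hVo.measurableSet fun ξ hξ => ?_
          rw [← ENNReal.ofReal_mul hX0.le, ← ofReal_norm]
          apply ENNReal.ofReal_le_ofReal
          refine (hB t ht ξ hξ).trans (le_of_eq ?_)
          rw [mul_assoc c₀, mul_comm (Metric.infDist ξ M ^ s)]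
      _ ≤ _ := by
          rw [lintegral_const_mul' _ _ ENNReal.ofReal_ne_top, ENNReal.ofReal_mul hX0.le]
          gcongr
          exact hC₁ _ hJ
  refine (hC₂ _ _ X hbc hbs (by positivity) hX0 hint hsup f hf.continuous hfc).trans (le_of_eq ?_)
  congr 2
  -- The truncated subtraction agrees with the real one because `1 ≤ L`.
  have hL : ((L - 1 : ℕ) : ℝ) = (L : ℝ) - 1 := by push_cast [hL1]; ring
  rw [Real.mul_rpow hX0.le (by positivity), Real.mul_rpow hC₁0.le (by positivity),
    ← Real.rpow_mul hJ.le, Real.rpow_add hJ, ← hL, Real.rpow_natCast]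
  -- Both norms carry the same `X`, so interpolation returns it whole and only the decay factor
  -- acquires the exponent `θ`.
  have hXX : X ^ θ * X ^ (1 - θ) = X := by
    rw [← Real.rpow_add hX0]; simp
  calc C₂ * (X ^ θ * (C₁ ^ θ * japanese t ^ (-((l : ℝ) / s) * θ)) * X ^ (1 - θ))
      = C₂ * ((X ^ θ * X ^ (1 - θ)) * (C₁ ^ θ * japanese t ^ (-((l : ℝ) / s) * θ))) := by ring
    _ = _ := by rw [hXX, hX]; ring
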